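/- Let $\mathbb T=\mathbb R/\mathbb Z$ and let $\mathbb T^{\mathbb N}$ be the infinite-dimensional torus, the Pontryagin dual of $\mathcal A=\bigoplus_{\mathbb N}\mathbb Z$. Let $\mathrm{Sub}(\mathbb T^{\mathbb N})$ be the space of closed subgroups with the Chabauty topology, let $\mathrm{CRS}(\mathbb T^{\mathbb N})$ be the set of Borel probability measures on $\mathrm{Sub}(\mathbb T^{\mathbb N})$ invariant under all continuous automorphisms of $\mathbb T^{\mathbb N}$, with the weak* topology, and let $\mathrm{CRS}^e(\mathbb T^{\mathbb N})$ be the set of its extreme points (indecomposable measures). For an integer $n\ge 0$ let $\mathrm{Ann}(n\mathcal A)=\{y\in\mathbb T^{\mathbb N}: ny=0\}$. For a finite abelian group $F$ let $\lambda_{(n,[F])}$ be the law of the random closed subgroup $\mathrm{Ann}(n\mathcal A)+h(F)$, where $h\in\mathrm{Hom}(F,\mathbb T^{\mathbb N})$ is distributed according to the Haar probability measure. Say that $F$ is over $n$ if every nontrivial direct summand $F_1$ of $F$ satisfies $nF_1\ne 0$, and that $\lambda$ corresponds to the pair $(n,[F])$ if $F$ is over $n$ and $\lambda=\lambda_{(n,[F])}$.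 **Theorem.** Let $\lambda_i\in\mathrm{CRS}^e(\mathbb T^{\mathbb N})$ ($i\in\mathbb N$) correspond to the pairs $(n_i,[F_i])$. 1. If $n_i\to\infty$, then $\lambda_i\to\delta_{\mathbb T^{\mathbb N}}$. 2. If the maximal order of an element of $F_i$ tends to infinity, then $\lambda_i\to\delta_{\mathbb T^{\mathbb N}}$. 3. Suppose that eventually $n_i=n$ and $F_i\cong F\oplus\bigoplus_{j=1}^s(\mathbb Z/q_j^{t_j}\mathbb Z)^{m_j(i)}$ for a fixed integer $n\ge 0$, finite abelian group $F$, integer $s\ge0$, primes $q_j$ and integers $t_j\ge0$, where $m_j(i)\to\infty$ as $i\to\infty$ for each $j$. Put $M=\mathrm{lcm}(n,q_1^{t_1},\dots,q_s^{t_s})$. Then $\lambda_{(M,[F])}$ is an indecomposable CRS and $\lambda_i\to\lambda_{(M,[F])}$. If $F$ is over $M$, this limit corresponds to the pair $(M,[F])$; in general $F=A\oplus B$ with $MB=0$ and $A$ over $M$, and the limit corresponds to the pair $(M,[A])$. 4. Every such sequence has a subsequence for which one of the following holds: $n_i\to\infty$; or $n_i$ is eventually constant and the maximal order of an element of $F_i$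 tends to infinity; or the hypotheses of 3 are satisfied. **Corollary.** $\mathrm{CRS}^e(\mathbb T^{\mathbb N})$ is closed in $\mathrm{CRS}(\mathbb T^{\mathbb N})$, and $\mathrm{CRS}(\mathbb T^{\mathbb N})$ is a Bauer simplex, i.e. a Choquet simplex (a compact convex set each of whose points is the barycenter of exactly one Borel probability measure carried by the extreme points) whose set of extreme points is closed. -/

import Mathlib

open MeasureTheory Filter Topology
open scoped NNReal ENNReal Pointwise

noncomputable section

/-! ### The Chabauty space of closed subgroups -/

section Chabauty

variable {G : Type*} [AddCommGroup G] [TopologicalSpace G]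

/-- The Chabauty topology on the set `Sub(G)` of closed subgroups of `G`: it is generated by the
sets `{H | H ∩ K = ∅}` with `K` compact and the sets `{H | H ∩ U ≠ ∅}` with `U` open. -/
instance chabautyTopology : TopologicalSpace (ClosedAddSubgroup G) :=
  TopologicalSpace.generateFrom
    ({s | ∃ K : Set G, IsCompact K ∧ s = {H : ClosedAddSubgroup G | Disjoint (H : Set G) K}} ∪
      {s | ∃ U : Set G, IsOpen U ∧ s = {H : ClosedAddSubgroup G | ((H : Set G) ∩ U).Nonempty}})

instance chabautyMeasurableSpace : MeasurableSpace (ClosedAddSubgroup G) :=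
  borel (ClosedAddSubgroup G)

instance chabautyBorelSpace : BorelSpace (ClosedAddSubgroup G) := ⟨rfl⟩

/-- The image `φ(H)` of a closed subgroup under a topological automorphism. -/
def ClosedAddSubgroup.mapAut (φ : G ≃ₜ+ G) (H : ClosedAddSubgroup G) : ClosedAddSubgroup G where
  toAddSubgroup := (H : AddSubgroup G).map (φ : G →+ G)
  isClosed' := φ.toHomeomorph.isClosedMap _ H.isClosed'

variable (G) in
/-- The group `G` as a closed subgroup of itself. -/
def ClosedAddSubgroup.full : ClosedAddSubgroup G where
  toAddSubgroup := ⊤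
  isClosed' := isClosed_univ

theorem ClosedAddSubgroup.coe_mapAut (φ : G ≃ₜ+ G) (H : ClosedAddSubgroup G) :
    (H.mapAut φ : Set G) = φ '' (H : Set G) := rfl

/-- The action of automorphisms on the Chabauty space is continuous, so that push-forwards of
measures under it are the genuine ones. -/
theorem ClosedAddSubgroup.continuous_mapAut (φ : G ≃ₜ+ G) :
    Continuous (ClosedAddSubgroup.mapAut φ) := by
  refine continuous_generateFrom_iff.2 ?_
  rintro s (⟨K, hK, rfl⟩ | ⟨U, hU, rfl⟩)
  · refine TopologicalSpace.isOpen_generateFrom_of_mem (Or.inl ⟨φ ⁻¹' K, ?_, ?_⟩)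
    · exact φ.toHomeomorph.isCompact_preimage.2 hK
    · ext H
      simp only [Set.mem_preimage, Set.mem_ofPred_eq, ClosedAddSubgroup.coe_mapAut,
        Set.disjoint_image_left]
  · refine TopologicalSpace.isOpen_generateFrom_of_mem (Or.inr ⟨φ ⁻¹' U, ?_, ?_⟩)
    · exact hU.preimage φ.continuous
    · ext H
      simp only [Set.mem_preimage, Set.mem_ofPred_eq, ClosedAddSubgroup.coe_mapAut,
        Set.image_inter_nonempty_iff]

end Chabauty

/-! ### Simplices of probability measures -/

section Simplex

variable {X : Type*} [TopologicalSpace X] [MeasurableSpace X] [BorelSpace X]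

/-- The extreme points (indecomposable elements) of a set `K` of probability measures: those
`μ ∈ K` that are not of the form `t μ₁ + (1 - t) μ₂` with `0 < t < 1` and `μ₁ ≠ μ₂` in `K`. -/
def extremeMeasures (K : Set (ProbabilityMeasure X)) : Set (ProbabilityMeasure X) :=
  {μ | (μ : Measure X) ∈
    Set.extremePoints ℝ≥0 ((fun ν : ProbabilityMeasure X => (ν : Measure X)) '' K)}

/-- `ω` represents `μ` : `μ` is the barycenter of `ω` in the weak* topology. -/
def IsBarycenter (ω : ProbabilityMeasure (ProbabilityMeasure X)) (μ : ProbabilityMeasure X) :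
    Prop :=
  ∀ f : BoundedContinuousFunction X ℝ,
    ∫ x, f x ∂(μ : Measure X) =
      ∫ ν, (∫ x, f x ∂(ν : Measure X)) ∂(ω : Measure (ProbabilityMeasure X))

/-- A set `K` of Borel probability measures on a compact metrizable space is a (metrizable)
Choquet simplex: it is weak*-compact and convex, and each of its elements is represented by exactly
one probability measure that is carried by the extreme points of `K`. -/
structure IsChoquetSimplex (K : Set (ProbabilityMeasure X)) : Prop where
  isCompact : IsCompact K
  convex : Convex ℝ≥0 ((fun ν : ProbabilityMeasure X => (ν : Measure X)) '' K)
  existsUnique_repr : ∀ μ ∈ K, ∃! ω : ProbabilityMeasure (ProbabilityMeasure X),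
    (∀ᵐ ν ∂(ω : Measure (ProbabilityMeasure X)), ν ∈ extremeMeasures K) ∧ IsBarycenter ω μ

/-- A Bauer simplex is a Choquet simplex whose set of extreme points is closed. -/
structure IsBauerSimplex (K : Set (ProbabilityMeasure X)) : Prop extends IsChoquetSimplex K where
  isClosed_extreme : IsClosed (extremeMeasures K)

end Simplex

/-! ### Characteristic random subgroups -/

section CRS

variable (G : Type*) [AddCommGroup G] [TopologicalSpace G]

/-- `CRS(G)`: the `Aut(G)`-invariant Borel probability measures on `Sub(G)`. -/
def CRS : Set (ProbabilityMeasure (ClosedAddSubgroup G)) :=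
  {μ | ∀ φ : G ≃ₜ+ G,
    (μ : Measure (ClosedAddSubgroup G)).map (ClosedAddSubgroup.mapAut φ) = μ}

/-- `CRSᵉ(G)`: the indecomposable elements of `CRS(G)`. -/
def CRSe : Set (ProbabilityMeasure (ClosedAddSubgroup G)) := extremeMeasures (CRS G)

/-- The point mass at `G`. -/
def diracFull : ProbabilityMeasure (ClosedAddSubgroup G) :=
  ⟨Measure.dirac (ClosedAddSubgroup.full G), inferInstance⟩

end CRS

/-! ### Finite abelian groups -/

/-- `F` is over `m` : every nontrivial direct summand `A` of `F` satisfies `mA ≠ 0`. -/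
def IsOver (F : Type*) [AddCommGroup F] (m : ℕ) : Prop :=
  ∀ A B : AddSubgroup F, IsCompl A B → A ≠ ⊥ → ∃ x ∈ A, m • x ≠ 0

/-- The maximal order of an element of the (finite) group `F`. -/
def maxOrder (F : Type*) [AddCommGroup F] : ℕ := sSup (Set.range fun x : F => addOrderOf x)

/-! ### The infinite-dimensional torus -/

/-- The infinite-dimensional torus `(ℝ/ℤ)^ℕ`, the dual of `⨁_ℕ ℤ`. -/
abbrev Torus : Type := ℕ → AddCircle (1 : ℝ)

/-- The duality pairing `y(x) = ∑ xᵢ yᵢ` between `⨁_ℕ ℤ` and the torus. -/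
def pairing (x : ℕ →₀ ℤ) (y : Torus) : AddCircle (1 : ℝ) := x.sum fun i a => a • y i

/-- The annihilator in the torus of a subgroup of `⨁_ℕ ℤ`. -/
def Ann (S : AddSubgroup (ℕ →₀ ℤ)) : AddSubgroup Torus where
  carrier := {y | ∀ x ∈ S, pairing x y = 0}
  zero_mem' := fun x _ => by simp [pairing]
  add_mem' := fun {a b} ha hb x hx => by
    have h1 := ha x hx
    have h2 := hb x hx
    simp only [pairing, Finsupp.sum] at h1 h2
    simp [pairing, Finsupp.sum, smul_add, Finset.sum_add_distrib, h1, h2]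
  neg_mem' := fun {a} ha x hx => by
    have h1 := ha x hx
    simp only [pairing, Finsupp.sum] at h1
    simp [pairing, Finsupp.sum, h1]

/-- The subgroup `n𝒜` of `𝒜 = ⨁_ℕ ℤ`. -/
def multiples (n : ℕ) : AddSubgroup (ℕ →₀ ℤ) := (nsmulAddMonoidHom n).range

theorem isClosed_Ann (S : AddSubgroup (ℕ →₀ ℤ)) : IsClosed (Ann S : Set Torus) := by
  have h : (Ann S : Set Torus) = ⋂ x ∈ S, {y | pairing x y = 0} := by
    ext y
    simp [Ann]
  rw [h]
  refine isClosed_biInter fun x _ => isClosed_eq ?_ continuous_const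
  unfold pairing Finsupp.sum
  fun_prop

section Law

variable (F : Type*) [AddCommGroup F] [TopologicalSpace F]

/-- `Hom(F, 𝕋^ℕ)` carries the compact-open topology and its Borel σ-algebra. -/
instance homMeasurableSpace : MeasurableSpace (F →ₜ+ Torus) := borel (F →ₜ+ Torus)

instance homBorelSpace : BorelSpace (F →ₜ+ Torus) := ⟨rfl⟩

variable {F} in
theorem coe_Ann_sup_range (n : ℕ) (h : F →ₜ+ Torus) :
    ((Ann (multiples n) ⊔ (h : F →+ Torus).range : AddSubgroup Torus) : Set Torus) =
      (Ann (multiples n) : Set Torus) + Set.range h := by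
  rw [AddSubgroup.add_normal]
  rfl

variable [DiscreteTopology F]

/-- The Haar probability measure on the compact group `Hom(F, 𝕋^ℕ)`. -/
def haarHom : Measure (F →ₜ+ Torus) := Measure.addHaarMeasure ⊤

instance haarHom_isProbabilityMeasure : IsProbabilityMeasure (haarHom F) :=
  ⟨by simpa [haarHom] using
    Measure.addHaarMeasure_self (K₀ := (⊤ : TopologicalSpace.PositiveCompacts (F →ₜ+ Torus)))⟩

variable [Finite F]

variable {F} in
/-- The closed subgroup `Ann(n𝒜) + h(F)` of the torus. -/
def annAddImage (n : ℕ) (h : F →ₜ+ Torus) : ClosedAddSubgroup Torus where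
  toAddSubgroup := Ann (multiples n) ⊔ (h : F →+ Torus).range
  isClosed' := by
    change IsClosed ((Ann (multiples n) ⊔ (h : F →+ Torus).range : AddSubgroup Torus) : Set Torus)
    rw [coe_Ann_sup_range]
    exact ((isClosed_Ann _).isCompact.add (Set.finite_range h).isCompact).isClosed

theorem continuous_annAddImage (n : ℕ) :
    Continuous (annAddImage n : (F →ₜ+ Torus) → ClosedAddSubgroup Torus) := by
  have hcoe : ∀ h : F →ₜ+ Torus, (annAddImage n h : Set Torus) =
      (Ann (multiples n) : Set Torus) + Set.range h := coe_Ann_sup_range n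
  have hev : ∀ x : F, Continuous fun h : F →ₜ+ Torus => h x := fun x =>
    (continuous_apply x).comp ContinuousAddMonoidHom.isClosedEmbedding_coe.continuous
  refine continuous_generateFrom_iff.2 ?_
  rintro s (⟨K, hK, rfl⟩ | ⟨U, hU, rfl⟩)
  · have hC : IsClosed (K - (Ann (multiples n) : Set Torus)) := by
      rw [← Set.sub_image_prod]
      exact ((hK.prod (isClosed_Ann _).isCompact).image continuous_sub).isClosed
    have : (annAddImage n : (F →ₜ+ Torus) → _) ⁻¹' {H | Disjoint (H : Set Torus) K} =
        (⋃ x : F, {h : F →ₜ+ Torus | h x ∈ K - (Ann (multiples n) : Set Torus)})ᶜ := by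
      ext h
      simp only [Set.mem_preimage, Set.mem_ofPred_eq, hcoe, Set.disjoint_left, Set.mem_compl_iff,
        Set.mem_iUnion, not_exists]
      constructor
      · rintro H x ⟨k, hk, a, ha, hka⟩
        exact H (Set.add_mem_add ha ⟨x, rfl⟩) (by rw [← hka]; simpa using hk)
      · rintro H _ ⟨a, ha, _, ⟨x, rfl⟩, rfl⟩ hk
        exact H x ⟨_, hk, a, ha, by simp⟩
    rw [this]
    exact (isClosed_iUnion_of_finite fun x => hC.preimage (hev x)).isOpen_compl
  · have : (annAddImage n : (F →ₜ+ Torus) → _) ⁻¹' {H | ((H : Set Torus) ∩ U).Nonempty} =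
        ⋃ x : F, ⋃ a ∈ Ann (multiples n), {h : F →ₜ+ Torus | a + h x ∈ U} := by
      ext h
      simp only [Set.mem_preimage, Set.mem_ofPred_eq, hcoe, Set.mem_iUnion]
      constructor
      · rintro ⟨_, ⟨a, ha, _, ⟨x, rfl⟩, rfl⟩, hU'⟩
        exact ⟨x, a, ha, hU'⟩
      · rintro ⟨x, a, ha, hU'⟩
        exact ⟨_, Set.add_mem_add ha ⟨x, rfl⟩, hU'⟩
    rw [this]
    exact isOpen_iUnion fun x => isOpen_biUnion fun a _ =>
      hU.preimage (continuous_const.add (hev x))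

/-- The law of the random closed subgroup `Ann(n𝒜) + h(F)` of the torus, where `h` is a
Haar-random homomorphism from `F` to the torus. -/
def pairLaw (n : ℕ) : ProbabilityMeasure (ClosedAddSubgroup Torus) :=
  ⟨(haarHom F).map (annAddImage n),
    Measure.isProbabilityMeasure_map (continuous_annAddImage F n).aemeasurable⟩

/-- The random subgroup `μ` corresponds to the pair `(n, [F])`. -/
def Corresponds (μ : ProbabilityMeasure (ClosedAddSubgroup Torus)) (n : ℕ) : Prop :=
  IsOver F n ∧ μ = pairLaw F n

end Law

/-! ### The three types of sequences of pairs -/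

section Types

/-- First type: `nᵢ → ∞`. -/
def IsTypeOne (n : ℕ → ℕ) : Prop := Tendsto n atTop atTop

/-- Second type: `nᵢ` stabilizes and the maximal order of elements of `Fᵢ` tends to `∞`. -/
def IsTypeTwo (n : ℕ → ℕ) (F : ℕ → Type*) [∀ i, AddCommGroup (F i)] : Prop :=
  (∃ N, ∀ᶠ i in atTop, n i = N) ∧ Tendsto (fun i => maxOrder (F i)) atTop atTop

/-- Third type: `nᵢ` stabilizes to `N`, eventually `Fᵢ ≅ E ⊕ ⨁ⱼ (ℤ/qⱼ^{tⱼ})^{mⱼ(i)}` with the `qⱼ`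
prime, and `mⱼ(i) → ∞` for every `j`. -/
def IsTypeThree (n : ℕ → ℕ) (F : ℕ → Type*) [∀ i, AddCommGroup (F i)] (N : ℕ)
    (E : Type*) [AddCommGroup E] (s : ℕ) (q t : Fin s → ℕ) (m : Fin s → ℕ → ℕ) : Prop :=
  (∀ᶠ i in atTop, n i = N) ∧ (∀ j, (q j).Prime) ∧
    (∀ᶠ i in atTop,
      Nonempty (F i ≃+ E × ((j : Fin s) → Fin (m j i) → ZMod (q j ^ t j)))) ∧
    ∀ j, Tendsto (m j) atTop atTop

/-- `lcm(N, q₁^{t₁}, …, q_s^{t_s})`. -/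
def limitModulus (N : ℕ) {s : ℕ} (q t : Fin s → ℕ) : ℕ :=
  Nat.lcm N (Finset.univ.lcm fun j => q j ^ t j)

end Types

end

noncomputable section

/-! ### Measures determined by a multiplicative family of functions -/

/-! By duality a closed subgroup of the torus is determined by its annihilator in `𝒜 = ⨁_ℕ ℤ`, and
each event `perp x` is clopen because the circle has no small subgroups. Hence the Chabauty space
embeds in a Cantor space, and a measure on it is determined by the probabilities that finite sets of
vectors annihilate the random subgroup. For an invariant measure, Smith normal form
(`exists_aut_diagonal`) replaces such a set by vectors `lᵢ eᵢ`, so a CRS is determined by the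
numbers `coeff μ l` (`CRS.ext_coeff`).

The structure theory is then a form of de Finetti's theorem. Conditioning on an event about `e₀` and
forgetting that coordinate gives a CRS again, so indecomposability forces independence: `coeff μ l`
is the product of the `coeff μ [lᵢ]`. By Krein–Milman the coefficients of every CRS are averages of
multiplicative ones (`coeff_CRS_subset_range`). Conversely, if a multiplicative `μ` is a mixture,
the values `coeff ν [d]` have zero variance about `coeff μ [d]` under the measures that represent
the two parts, so both parts equal `μ`. Thus the indecomposable CRS are exactly the multiplicative
ones (`CRSe_eq_multiplicativeCRS`), a closed condition. Representing measures are unique by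
Stone–Weierstrass, because on this set a product of coefficients is the coefficient of the
concatenated list.

Convergence of multiplicative CRS amounts to convergence of `coeff _ [d]` for every `d`. For
`pairLaw F n` this number is the proportion of `d`-torsion in `F` if `n ∣ d`, and `0` otherwise
(`coeff_pairLaw_singleton`). The proportion equals `1 / |dF|`, which is small for `d > 0` when `F`
has elements of large order. For `(ℤ/q^t)^m` with `m → ∞` it tends to `1` or `0` according to
whether `q^t ∣ d`, so growing factors turn into a divisibility condition that the lcm absorbs. The
subsequence is found by pigeonhole on `nᵢ`, on the maximal order, and on the multiplicities of the
finitely many possible cyclic summands. -/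

theorem measure_ext_of_submonoid_integral_eq {X 𝕜 : Type*} [RCLike 𝕜] [TopologicalSpace X]
    [PolishSpace X] [MeasurableSpace X] [BorelSpace X]
    (S : Submonoid (BoundedContinuousFunction X 𝕜)) (hstar : ∀ f ∈ S, star f ∈ S)
    (hsep : ∀ x y, x ≠ y → ∃ f ∈ S, f x ≠ f y)
    (P P' : Measure X) [IsFiniteMeasure P] [IsFiniteMeasure P']
    (h : ∀ f ∈ S, ∫ x, f x ∂P = ∫ x, f x ∂P') : P = P' := by
  let A : StarSubalgebra 𝕜 (BoundedContinuousFunction X 𝕜) :=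
    { toSubalgebra := Algebra.adjoin 𝕜 S
      star_mem' := by
        change Algebra.adjoin 𝕜 (S : Set (BoundedContinuousFunction X 𝕜)) ≤
          star (Algebra.adjoin 𝕜 (S : Set (BoundedContinuousFunction X 𝕜)))
        exact Algebra.adjoin_le fun f hf => Algebra.subset_adjoin (hstar f hf) }
  refine ext_of_forall_mem_subalgebra_integral_eq_of_polish (𝕜 := 𝕜) (A := A) ?_ ?_
  · intro x y hxy
    obtain ⟨f, hf, hne⟩ := hsep x y hxy
    exact ⟨f, ⟨_, ⟨f, Algebra.subset_adjoin hf, rfl⟩, rfl⟩, hne⟩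
  · intro g hg
    -- The family is closed under products, so the algebra it generates is its linear span and the
    -- hypothesis extends by linearity.
    have hg' : g ∈ Submodule.span 𝕜 (S : Set (BoundedContinuousFunction X 𝕜)) := by
      have := Algebra.adjoin_eq_span 𝕜 (S : Set (BoundedContinuousFunction X 𝕜))
      rw [Submonoid.closure_eq] at this
      rw [← this]
      exact hg
    clear hg
    induction hg' using Submodule.span_induction with
    | mem f hf => exact h f hf
    | zero => simp
    | add f g _ _ hf hg =>
      simp only [BoundedContinuousFunction.coe_add, Pi.add_apply]
      rw [integral_add (f.integrable _) (g.integrable _), integral_add (f.integrable _)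
        (g.integrable _), hf, hg]
    | smul a f hf' hf =>
      simp only [BoundedContinuousFunction.coe_smul]
      rw [integral_smul, integral_smul, hf]

/-! ### Compactness of the Chabauty space -/

section Chabauty

variable {G : Type*} [AddCommGroup G] [TopologicalSpace G]

theorem ClosedAddSubgroup.isOpen_disjoint {K : Set G} (hK : IsCompact K) :
    IsOpen {H : ClosedAddSubgroup G | Disjoint (H : Set G) K} :=
  TopologicalSpace.isOpen_generateFrom_of_mem (Or.inl ⟨K, hK, rfl⟩)

theorem ClosedAddSubgroup.isOpen_inter_nonempty {U : Set G} (hU : IsOpen U) :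
    IsOpen {H : ClosedAddSubgroup G | ((H : Set G) ∩ U).Nonempty} :=
  TopologicalSpace.isOpen_generateFrom_of_mem (Or.inr ⟨U, hU, rfl⟩)

/-- The limit of an ultrafilter of closed subgroups. -/
def Ultrafilter.limSubgroup [IsTopologicalAddGroup G] (f : Ultrafilter (ClosedAddSubgroup G)) :
    ClosedAddSubgroup G where
  carrier := {y | ∀ U : Set G, IsOpen U → y ∈ U → 
    ∀ᶠ H : ClosedAddSubgroup G in (f : Filter (ClosedAddSubgroup G)), ((H : Set G) ∩ U).Nonempty}
  zero_mem' := fun U _ h0 => Eventually.of_forall fun H => ⟨0, H.zero_mem, h0⟩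
  add_mem' := by
    intro a b ha hb U hU hab
    obtain ⟨V, W, hV, hW, haV, hbW, hVW⟩ :=
      isOpen_prod_iff.1 (hU.preimage (continuous_add (M := G))) a b hab
    filter_upwards [ha V hV haV, hb W hW hbW] with H h1 h2
    obtain ⟨v, hv, hvV⟩ := h1
    obtain ⟨w, hw, hwW⟩ := h2
    exact ⟨v + w, H.add_mem hv hw, hVW (Set.mk_mem_prod hvV hwW)⟩
  neg_mem' := by
    intro a ha U hU hU'
    filter_upwards [ha _ (hU.preimage continuous_neg) hU'] with H h1
    obtain ⟨v, hv, hvV⟩ := h1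
    exact ⟨-v, H.neg_mem hv, hvV⟩
  isClosed' := by
    rw [← isOpen_compl_iff, isOpen_iff_forall_mem_open]
    intro y hy
    simp only [Set.mem_compl_iff, Set.mem_ofPred_eq, not_forall] at hy
    obtain ⟨U, hU, hyU, hn⟩ := hy
    exact ⟨U, fun z hz hz' => hn (hz' U hU hz), hU, hyU⟩

theorem Ultrafilter.mem_limSubgroup [IsTopologicalAddGroup G]
    {f : Ultrafilter (ClosedAddSubgroup G)} {y : G} :
    y ∈ f.limSubgroup ↔ ∀ U : Set G, IsOpen U → y ∈ U →
      ∀ᶠ H : ClosedAddSubgroup G in (f : Filter (ClosedAddSubgroup G)),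
        ((H : Set G) ∩ U).Nonempty := Iff.rfl

/-- Every ultrafilter converges to its `limSubgroup`. For the sets of subgroups missing `K`, each
point of `K` has a neighbourhood that almost every subgroup misses, and finitely many of these cover
`K`. Local compactness of `G` plays no role. -/
instance ClosedAddSubgroup.compactSpace [IsTopologicalAddGroup G] :
    CompactSpace (ClosedAddSubgroup G) := by
  refine ⟨isCompact_iff_ultrafilter_le_nhds.2 fun f _ => ⟨f.limSubgroup, trivial, ?_⟩⟩
  rw [TopologicalSpace.nhds_generateFrom]
  refine le_iInf₂ fun s hs => le_principal_iff.2 ?_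
  obtain ⟨hmem, ⟨K, hK, rfl⟩ | ⟨U, hU, rfl⟩⟩ := hs
  · have h1 : ∀ y ∈ K, ∃ U : Set G, IsOpen U ∧ y ∈ U ∧
        ∀ᶠ H : ClosedAddSubgroup G in (f : Filter (ClosedAddSubgroup G)),
          ¬ ((H : Set G) ∩ U).Nonempty := by
      intro y hy
      have : y ∉ f.limSubgroup := fun h => Set.disjoint_left.1 hmem h hy
      rw [Ultrafilter.mem_limSubgroup] at this
      simp only [not_forall] at this
      obtain ⟨U, hU, hyU, hn⟩ := this
      exact ⟨U, hU, hyU, Ultrafilter.eventually_not.2 hn⟩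
    choose! U hU hyU hn using h1
    obtain ⟨t, htK, ht⟩ := hK.elim_nhds_subcover U fun y hy => (hU y hy).mem_nhds (hyU y hy)
    have : ∀ᶠ H : ClosedAddSubgroup G in (f : Filter (ClosedAddSubgroup G)),
        ∀ y ∈ t, ¬ ((H : Set G) ∩ U y).Nonempty :=
      (eventually_all_finset t).2 fun y hy => hn y (htK y hy)
    filter_upwards [this] with H hH
    refine Set.disjoint_left.2 fun z hz hzK => ?_
    obtain ⟨y, hy, hzy⟩ := Set.mem_iUnion₂.1 (ht hzK)
    exact hH y hy ⟨z, hz, hzy⟩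
  · obtain ⟨y, hy, hyU⟩ := hmem
    exact Ultrafilter.mem_limSubgroup.1 hy U hU hyU

end Chabauty

/-! ### Duality for closed subgroups of the torus -/

theorem pairing_add_left (x x' : ℕ →₀ ℤ) (y : Torus) :
    pairing (x + x') y = pairing x y + pairing x' y :=
  Finsupp.sum_add_index' (fun _ => zero_smul _ _) fun _ _ _ => add_smul _ _ _

theorem pairing_add_right (x : ℕ →₀ ℤ) (y y' : Torus) :
    pairing x (y + y') = pairing x y + pairing x y' := by
  simp [pairing, Finsupp.sum, smul_add, Finset.sum_add_distrib]

theorem pairing_single (i : ℕ) (a : ℤ) (y : Torus) : pairing (Finsupp.single i a) y = a • y i :=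
  Finsupp.sum_single_index (zero_smul _ _)

theorem continuous_pairing (x : ℕ →₀ ℤ) : Continuous (pairing x) := by
  unfold pairing Finsupp.sum
  fun_prop

/-- The pairing as a biadditive map. -/
def pairingHom : (ℕ →₀ ℤ) →+ Torus →+ AddCircle (1 : ℝ) :=
  AddMonoidHom.mk' (fun x => AddMonoidHom.mk' (pairing x) (pairing_add_right x)) fun x x' => by
    ext y
    exact pairing_add_left x x' y

theorem pairingHom_apply (x : ℕ →₀ ℤ) (y : Torus) : pairingHom x y = pairing x y := rfl

/-- The character of the torus given by `x`, as a bounded continuous function. -/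
def torusChar (x : ℕ →₀ ℤ) : BoundedContinuousFunction Torus ℂ :=
  BoundedContinuousFunction.mkOfCompact
    ⟨fun y => ((pairing x y).toCircle : ℂ), by
      have := continuous_pairing x
      have h2 : Continuous (AddCircle.toCircle (T := (1 : ℝ))) := AddCircle.continuous_toCircle
      exact continuous_subtype_val.comp (h2.comp this)⟩

theorem torusChar_apply (x : ℕ →₀ ℤ) (y : Torus) :
    torusChar x y = ((pairing x y).toCircle : ℂ) := rfl

theorem torusChar_add_apply (x : ℕ →₀ ℤ) (y y' : Torus) :
    torusChar x (y + y') = torusChar x y * torusChar x y' := by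
  simp [torusChar_apply, pairing_add_right, AddCircle.toCircle_add]

theorem torusChar_eq_one_iff (x : ℕ →₀ ℤ) (y : Torus) : torusChar x y = 1 ↔ pairing x y = 0 := by
  rw [torusChar_apply, ← Circle.coe_one, Circle.coe_inj, ← AddCircle.toCircle_zero (T := (1 : ℝ))]
  exact (AddCircle.injective_toCircle one_ne_zero).eq_iff

/-- The characters of the torus determine finite measures on it. -/
theorem measure_ext_of_torusChar (P P' : Measure Torus) [IsFiniteMeasure P] [IsFiniteMeasure P']
    (h : ∀ x, ∫ y, torusChar x y ∂P = ∫ y, torusChar x y ∂P') : P = P' := by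
  let S : Submonoid (BoundedContinuousFunction Torus ℂ) :=
    { carrier := Set.range torusChar
      one_mem' := ⟨0, by ext y; simp [torusChar_apply, ← pairingHom_apply]⟩
      mul_mem' := by
        rintro _ _ ⟨x, rfl⟩ ⟨x', rfl⟩
        exact ⟨x + x', by ext y; simp [torusChar_apply, pairing_add_left, AddCircle.toCircle_add]⟩ }
  refine measure_ext_of_submonoid_integral_eq S ?_ ?_ P P' ?_
  · rintro _ ⟨x, rfl⟩
    refine ⟨-x, ?_⟩
    ext y
    simp [torusChar_apply, ← pairingHom_apply, AddCircle.toCircle_neg, ← Circle.coe_inv_eq_conj]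
  · intro y y' hne
    obtain ⟨i, hi⟩ := Function.ne_iff.1 hne
    refine ⟨_, ⟨Finsupp.single i 1, rfl⟩, fun h => hi ?_⟩
    simp only [torusChar_apply, pairing_single, one_smul, Circle.coe_inj] at h
    exact AddCircle.injective_toCircle one_ne_zero h
  · rintro _ ⟨x, rfl⟩
    exact h x

/-- A closed subgroup of the torus is separated from the points outside it by characters. -/
theorem exists_pairing_ne_zero (H : ClosedAddSubgroup Torus) {y : Torus} (hy : y ∉ H) :
    ∃ x : ℕ →₀ ℤ, (∀ h ∈ H, pairing x h = 0) ∧ pairing x y ≠ 0 := by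
  by_contra! hcon
  let K : AddSubgroup Torus := H.toAddSubgroup
  have hK : IsClosed (K : Set Torus) := H.isClosed'
  have : CompactSpace K := isCompact_iff_compactSpace.1 hK.isCompact
  let m : Measure K := Measure.addHaarMeasure ⊤
  have hm : IsProbabilityMeasure m := ⟨by
    simpa [m] using Measure.addHaarMeasure_self (K₀ := (⊤ : TopologicalSpace.PositiveCompacts K))⟩
  have hcv : Measurable (Subtype.val : K → Torus) := measurable_subtype_coe
  let P := m.map (Subtype.val : K → Torus)
  have hP : IsProbabilityMeasure P := Measure.isProbabilityMeasure_map hcv.aemeasurable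
  have hy' : Measurable fun z : Torus => y + z := (continuous_const.add continuous_id).measurable
  let P' := P.map (fun z => y + z)
  have hP' : IsProbabilityMeasure P' := Measure.isProbabilityMeasure_map hy'.aemeasurable
  -- Haar measure on `H` and its translate by `y` have the same Fourier coefficients: a character
  -- trivial on `H` is trivial at `y` by `hcon`, and any other one integrates to zero over `H`. Yet
  -- the first measure lives on `H` and the second off it.
  have hPP : P = P' := by
    refine measure_ext_of_torusChar P P' fun x => ?_
    have e1 : ∫ z, torusChar x z ∂P' = torusChar x y * ∫ z, torusChar x z ∂P := by
      rw [integral_map hy'.aemeasurable (torusChar x).continuous.aestronglyMeasurable]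
      simp only [torusChar_add_apply]
      rw [integral_const_mul]
    rw [e1]
    by_cases hx : ∀ h ∈ H, pairing x h = 0
    · rw [(torusChar_eq_one_iff x y).2 (hcon x hx), one_mul]
    · push Not at hx
      obtain ⟨h, hh, hne⟩ := hx
      have e2 : ∫ z, torusChar x z ∂P = torusChar x h * ∫ z, torusChar x z ∂P := by
        rw [integral_map hcv.aemeasurable (torusChar x).continuous.aestronglyMeasurable]
        conv_lhs => rw [← integral_add_left_eq_self _ (⟨h, hh⟩ : K)]
        simp only [AddSubgroup.coe_add, torusChar_add_apply]
        rw [integral_const_mul]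
      have e3 : ∫ z, torusChar x z ∂P = 0 := by
        have h1 : torusChar x h ≠ 1 := fun h1 => hne ((torusChar_eq_one_iff x h).1 h1)
        have : (1 - torusChar x h) * ∫ z, torusChar x z ∂P = 0 := by
          rw [sub_mul, one_mul, ← e2, sub_self]
        exact (mul_eq_zero.1 this).resolve_left (sub_ne_zero.2 h1.symm)
      rw [e3, mul_zero]
  have h1 : P (K : Set Torus) = 1 := by
    rw [Measure.map_apply hcv hK.measurableSet]
    have : (Subtype.val : K → Torus) ⁻¹' (K : Set Torus) = Set.univ := by
      ext z
      simp
    rw [this, measure_univ]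
  have h2 : P' (K : Set Torus) = 0 := by
    rw [Measure.map_apply hy' hK.measurableSet, Measure.map_apply hcv
      (hy' hK.measurableSet)]
    have : (Subtype.val : K → Torus) ⁻¹' ((fun z => y + z) ⁻¹' (K : Set Torus)) = ∅ := by
      ext z
      simp only [Set.mem_preimage, SetLike.mem_coe, Set.mem_empty_iff_false, iff_false]
      intro hz
      exact hy ((K.add_mem_cancel_right z.2).1 hz)
    rw [this, measure_empty]
  rw [← hPP, h1] at h2
  exact one_ne_zero h2

/-! ### The Chabauty space of the torus -/

/-- The closed subgroups of the torus annihilated by `x`. -/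
def perp (x : ℕ →₀ ℤ) : Set (ClosedAddSubgroup Torus) := {H | ∀ y ∈ H, pairing x y = 0}

theorem isClosed_perp (x : ℕ →₀ ℤ) : IsClosed (perp x) := by
  have : (perp x)ᶜ = {H : ClosedAddSubgroup Torus |
      ((H : Set Torus) ∩ {y | pairing x y ≠ 0}).Nonempty} := by
    ext H
    simp [perp, Set.Nonempty]
  rw [← isOpen_compl_iff, this]
  exact ClosedAddSubgroup.isOpen_inter_nonempty
    (isOpen_ne_fun (continuous_pairing x) continuous_const)

theorem AddCircle.norm_two_nsmul {z : AddCircle (1 : ℝ)} (hz : ‖z‖ < 1 / 4) :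
    ‖(2 : ℕ) • z‖ = 2 * ‖z‖ := by
  induction z using QuotientAddGroup.induction_on with
  | H t =>
  have h1 : ((t - round t : ℝ) : AddCircle (1 : ℝ)) = (t : AddCircle (1 : ℝ)) := by
    rw [AddCircle.coe_sub, sub_eq_self, AddCircle.coe_eq_zero_iff]
    exact ⟨round t, by simp⟩
  have h2 : ‖(t : AddCircle (1 : ℝ))‖ = |t - round t| := UnitAddCircle.norm_eq
  change ‖(2 : ℕ) • (t : AddCircle (1 : ℝ))‖ = 2 * ‖(t : AddCircle (1 : ℝ))‖
  change ‖(t : AddCircle (1 : ℝ))‖ < 1 / 4 at hz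
  rw [h2] at hz ⊢
  rw [← h1, ← AddCircle.coe_nsmul, (AddCircle.norm_coe_eq_abs_iff 1 one_ne_zero).2]
  · simp [abs_mul]
  · simp only [nsmul_eq_mul, Nat.cast_ofNat, abs_mul, abs_one, Nat.abs_ofNat]
    linarith

/-- The circle has no small subgroups. -/
theorem AddCircle.exists_le_norm_nsmul {z : AddCircle (1 : ℝ)} (hz : z ≠ 0) :
    ∃ n : ℕ, 1 / 4 ≤ ‖n • z‖ := by
  by_contra! hcon
  -- While all multiples stay within `1/4` of zero, doubling never wraps around, so the norm would
  -- grow without bound.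
  have h : ∀ k : ℕ, ‖(2 ^ k : ℕ) • z‖ = 2 ^ k * ‖z‖ := by
    intro k
    induction k with
    | zero => simp
    | succ k ih =>
      rw [pow_succ', mul_smul, AddCircle.norm_two_nsmul (hcon _), ih, pow_succ', mul_assoc]
  have hpos : 0 < ‖z‖ := norm_pos_iff.2 hz
  obtain ⟨k, hk⟩ := pow_unbounded_of_one_lt (1 / ‖z‖) (one_lt_two)
  have h1 := hcon (2 ^ k)
  rw [h, div_lt_iff₀ hpos] at *
  linarith

/-- The image of `H` under `pairing x` is a subgroup of the circle, hence trivial as soon as it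
stays within distance `1/4` of zero. So annihilation by `x` amounts to missing a compact set. -/
theorem isOpen_perp (x : ℕ →₀ ℤ) : IsOpen (perp x) := by
  have : perp x = {H : ClosedAddSubgroup Torus |
      Disjoint (H : Set Torus) {y | 1 / 4 ≤ ‖pairing x y‖}} := by
    ext H
    simp only [perp, Set.mem_ofPred_eq, Set.disjoint_left, not_le]
    constructor
    · intro h y hy
      rw [h y hy]
      norm_num
    · intro h y hy
      by_contra hne
      obtain ⟨n, hn⟩ := AddCircle.exists_le_norm_nsmul hne
      have := h (a := n • y) (H.nsmul_mem hy n)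
      rw [← pairingHom_apply, map_nsmul, pairingHom_apply] at this
      linarith
  rw [this]
  exact ClosedAddSubgroup.isOpen_disjoint
    (isClosed_le continuous_const (continuous_pairing x).norm).isCompact

theorem isClopen_perp (x : ℕ →₀ ℤ) : IsClopen (perp x) := ⟨isClosed_perp x, isOpen_perp x⟩

open Classical in
/-- The embedding of the Chabauty space of the torus in a Cantor space. -/
def perpCode (H : ClosedAddSubgroup Torus) (x : ℕ →₀ ℤ) : Bool := decide (H ∈ perp x)

theorem perpCode_eq_true {H : ClosedAddSubgroup Torus} {x : ℕ →₀ ℤ} :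
    perpCode H x = true ↔ H ∈ perp x := by
  simp [perpCode]

theorem perpCode_injective : Function.Injective perpCode := by
  have key : ∀ H H' : ClosedAddSubgroup Torus, perpCode H = perpCode H' → ∀ y ∈ H, y ∈ H' := by
    intro H H' h y hy
    by_contra hn
    obtain ⟨x, hx, hne⟩ := exists_pairing_ne_zero H' hn
    have : H ∈ perp x := by rw [← perpCode_eq_true, h, perpCode_eq_true]; exact hx
    exact hne (this y hy)
  intro H H' h
  exact SetLike.ext fun y => ⟨key H H' h y, key H' H h.symm y⟩

theorem continuous_perpCode : Continuous perpCode := by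
  refine continuous_pi fun x => continuous_discrete_rng.2 ?_
  intro b
  cases b
  · convert (isClosed_perp x).isOpen_compl using 1
    ext H
    simp [perpCode]
  · convert isOpen_perp x using 1
    ext H
    simp [perpCode]

theorem isClosedEmbedding_perpCode : IsClosedEmbedding perpCode :=
  continuous_perpCode.isClosedEmbedding perpCode_injective

instance : T2Space (ClosedAddSubgroup Torus) := isClosedEmbedding_perpCode.isEmbedding.t2Space

instance : SecondCountableTopology (ClosedAddSubgroup Torus) :=
  isClosedEmbedding_perpCode.isEmbedding.secondCountableTopology

instance : TopologicalSpace.MetrizableSpace (ClosedAddSubgroup Torus) :=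
  isClosedEmbedding_perpCode.isEmbedding.metrizableSpace

/-- The closed subgroups annihilated by a finite set. -/
def perpFinset (B : Finset (ℕ →₀ ℤ)) : Set (ClosedAddSubgroup Torus) := ⋂ x ∈ B, perp x

theorem mem_perpFinset {B : Finset (ℕ →₀ ℤ)} {H : ClosedAddSubgroup Torus} :
    H ∈ perpFinset B ↔ ∀ x ∈ B, H ∈ perp x := by
  simp [perpFinset]

theorem isClopen_perpFinset (B : Finset (ℕ →₀ ℤ)) : IsClopen (perpFinset B) :=
  B.finite_toSet.isClopen_biInter fun x _ => isClopen_perp x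

theorem isPiSystem_perpFinset : IsPiSystem (Set.range perpFinset) := by
  classical
  rintro _ ⟨B, rfl⟩ _ ⟨B', rfl⟩ _
  refine ⟨B ∪ B', ?_⟩
  ext H
  simp only [mem_perpFinset, Set.mem_inter_iff, Finset.mem_union]
  grind

theorem generateFrom_perpFinset :
    chabautyMeasurableSpace = MeasurableSpace.generateFrom (Set.range perpFinset) := by
  apply le_antisymm
  · have h1 : (chabautyMeasurableSpace : MeasurableSpace (ClosedAddSubgroup Torus)) =
        MeasurableSpace.comap perpCode (borel ((ℕ →₀ ℤ) → Bool)) := by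
      rw [← borel_comap, ← isClosedEmbedding_perpCode.isInducing.eq_induced]
      rfl
    rw [h1, ← (inferInstance : BorelSpace ((ℕ →₀ ℤ) → Bool)).measurable_eq]
    let _ : MeasurableSpace (ClosedAddSubgroup Torus) :=
      MeasurableSpace.generateFrom (Set.range perpFinset)
    refine measurable_iff_comap_le.1 (measurable_pi_iff.2 fun x => ?_)
    refine measurable_to_bool ?_
    have : (fun H => perpCode H x) ⁻¹' {true} = perpFinset {x} := by
      ext H
      simp [mem_perpFinset, perpCode_eq_true]
    rw [this]
    exact MeasurableSpace.measurableSet_generateFrom ⟨_, rfl⟩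
  · refine MeasurableSpace.generateFrom_le ?_
    rintro _ ⟨B, rfl⟩
    exact (isClopen_perpFinset B).isOpen.measurableSet

theorem measure_ext_of_perpFinset (μ ν : Measure (ClosedAddSubgroup Torus))
    [IsProbabilityMeasure μ] [IsProbabilityMeasure ν]
    (h : ∀ B, μ (perpFinset B) = ν (perpFinset B)) : μ = ν :=
  ext_of_generate_finite _ generateFrom_perpFinset isPiSystem_perpFinset
    (by rintro _ ⟨B, rfl⟩; exact h B) (by simp)

/-! ### Endomorphisms of the torus -/

/-- Both sides are additive in `x`, so the basis vectors suffice. This gives the adjunction formula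
both for dual endomorphisms and for the shift. -/
theorem pairing_eq_of_single (f : (ℕ →₀ ℤ) →+ (ℕ →₀ ℤ)) (y z : Torus)
    (h : ∀ i, z i = pairing (f (Finsupp.single i 1)) y) (x : ℕ →₀ ℤ) :
    pairing x z = pairing (f x) y := by
  have : pairingHom.flip z = (pairingHom.flip y).comp f := by
    ext i
    simp [pairingHom_apply, pairing_single, h]
  exact DFunLike.congr_fun this x

/-- The endomorphism of the torus dual to an endomorphism of `⨁_ℕ ℤ`. -/
def dualHom (f : (ℕ →₀ ℤ) →+ (ℕ →₀ ℤ)) : Torus →+ Torus :=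
  AddMonoidHom.mk' (fun y i => pairing (f (Finsupp.single i 1)) y) fun y y' => by
    ext i
    exact pairing_add_right _ y y'

theorem pairing_dualHom (f : (ℕ →₀ ℤ) →+ (ℕ →₀ ℤ)) (x : ℕ →₀ ℤ) (y : Torus) :
    pairing x (dualHom f y) = pairing (f x) y :=
  pairing_eq_of_single f y _ (fun _ => rfl) x

theorem continuous_dualHom (f : (ℕ →₀ ℤ) →+ (ℕ →₀ ℤ)) : Continuous (dualHom f) :=
  continuous_pi fun _ => continuous_pairing _

theorem torus_ext_pairing {y z : Torus} (h : ∀ x, pairing x y = pairing x z) : y = z := by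
  ext i
  simpa [pairing_single] using h (Finsupp.single i 1)

/-- The automorphism of the torus dual to an automorphism of `⨁_ℕ ℤ`. -/
def dualAut (α : (ℕ →₀ ℤ) ≃+ (ℕ →₀ ℤ)) : Torus ≃ₜ+ Torus where
  toFun := dualHom α
  invFun := dualHom α.symm
  left_inv y := torus_ext_pairing fun x => by simp [pairing_dualHom]
  right_inv y := torus_ext_pairing fun x => by simp [pairing_dualHom]
  map_add' := map_add _
  continuous_toFun := continuous_dualHom _
  continuous_invFun := continuous_dualHom _

theorem pairing_dualAut (α : (ℕ →₀ ℤ) ≃+ (ℕ →₀ ℤ)) (x : ℕ →₀ ℤ) (y : Torus) :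
    pairing x (dualAut α y) = pairing (α x) y :=
  pairing_dualHom _ x y

/-- Through this, invariance of a random subgroup under automorphisms of the torus becomes
invariance of its event probabilities under automorphisms of `⨁_ℕ ℤ`. -/
theorem mapAut_dualAut_mem_perp (α : (ℕ →₀ ℤ) ≃+ (ℕ →₀ ℤ)) (x : ℕ →₀ ℤ)
    (H : ClosedAddSubgroup Torus) : H.mapAut (dualAut α) ∈ perp x ↔ H ∈ perp (α x) := by
  constructor
  · intro h y hy
    rw [← pairing_dualAut]
    exact h _ ⟨y, hy, rfl⟩
  · rintro h _ ⟨y, hy, rfl⟩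
    exact (pairing_dualAut α x y).trans (h y hy)

/-- The subgroup of `⨁_ℕ ℤ` that annihilates `H`. -/
def annihilator (H : ClosedAddSubgroup Torus) : AddSubgroup (ℕ →₀ ℤ) where
  carrier := {x | H ∈ perp x}
  zero_mem' := fun y _ => by simp [← pairingHom_apply]
  add_mem' := fun ha hb y hy => by rw [pairing_add_left, ha y hy, hb y hy, add_zero]
  neg_mem' := fun {a} ha y hy => by
    rw [← pairingHom_apply, map_neg, AddMonoidHom.neg_apply, pairingHom_apply, ha y hy, neg_zero]

theorem mem_annihilator {H : ClosedAddSubgroup Torus} {x : ℕ →₀ ℤ} :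
    x ∈ annihilator H ↔ H ∈ perp x := Iff.rfl

/-! ### The shift -/

/-- The continuous endomorphism of the torus that forgets the zeroth coordinate. -/
def shiftHom : Torus →+ Torus := AddMonoidHom.mk' (fun y i => y (i + 1)) fun _ _ => rfl

theorem shiftHom_apply (y : Torus) (i : ℕ) : shiftHom y i = y (i + 1) := rfl

theorem continuous_shiftHom : Continuous shiftHom :=
  continuous_pi fun i => continuous_apply (i + 1)

theorem pairing_shiftHom (x : ℕ →₀ ℤ) (y : Torus) :
    pairing x (shiftHom y) = pairing (x.mapDomain Nat.succ) y :=
  pairing_eq_of_single (Finsupp.mapDomain.addMonoidHom Nat.succ) y _ (fun i => by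
    simp [Finsupp.mapDomain_single, pairing_single, shiftHom_apply]) x

/-- The image of a closed subgroup under the shift. -/
def shiftMap (H : ClosedAddSubgroup Torus) : ClosedAddSubgroup Torus where
  toAddSubgroup := (H : AddSubgroup Torus).map shiftHom
  isClosed' := (H.isClosed'.isCompact.image continuous_shiftHom).isClosed

theorem shiftMap_mem_perp {H : ClosedAddSubgroup Torus} {x : ℕ →₀ ℤ} :
    shiftMap H ∈ perp x ↔ H ∈ perp (x.mapDomain Nat.succ) := by
  constructor
  · intro h y hy
    rw [← pairing_shiftHom]
    exact h _ ⟨y, hy, rfl⟩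
  · rintro h _ ⟨y, hy, rfl⟩
    exact (pairing_shiftHom x y).trans (h y hy)

theorem continuous_shiftMap : Continuous shiftMap := by
  rw [isClosedEmbedding_perpCode.isInducing.continuous_iff]
  have : perpCode ∘ shiftMap = fun H x => perpCode H (x.mapDomain Nat.succ) := by
    ext H x
    rw [Function.comp_apply, Bool.eq_iff_iff, perpCode_eq_true, perpCode_eq_true,
      shiftMap_mem_perp]
  rw [this]
  exact continuous_pi fun x => (continuous_apply _).comp continuous_perpCode

/-- The automorphism that fixes the zeroth coordinate and acts by `g` on the others. -/
def consAut (g : Torus ≃ₜ+ Torus) : Torus ≃ₜ+ Torus where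
  toFun y i := Nat.casesOn i (y 0) (g (shiftHom y))
  invFun y i := Nat.casesOn i (y 0) (g.symm (shiftHom y))
  left_inv y := by
    ext i
    cases i with
    | zero => rfl
    | succ i => exact congrFun (g.symm_apply_apply (shiftHom y)) i
  right_inv y := by
    ext i
    cases i with
    | zero => rfl
    | succ i => exact congrFun (g.apply_symm_apply (shiftHom y)) i
  map_add' y z := by
    ext i
    cases i with
    | zero => rfl
    | succ i =>
      change g (shiftHom (y + z)) i = g (shiftHom y) i + g (shiftHom z) i
      rw [map_add, map_add]
      rfl
  continuous_toFun := by
    refine continuous_pi fun i => ?_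
    cases i with
    | zero => exact continuous_apply 0
    | succ i => exact (continuous_apply i).comp (g.continuous_toFun.comp continuous_shiftHom)
  continuous_invFun := by
    refine continuous_pi fun i => ?_
    cases i with
    | zero => exact continuous_apply 0
    | succ i => exact (continuous_apply i).comp (g.continuous_invFun.comp continuous_shiftHom)

theorem consAut_zero (g : Torus ≃ₜ+ Torus) (y : Torus) : consAut g y 0 = y 0 := rfl

theorem shiftHom_consAut (g : Torus ≃ₜ+ Torus) (y : Torus) :
    shiftHom (consAut g y) = g (shiftHom y) := rfl

theorem shiftMap_mapAut_consAut (g : Torus ≃ₜ+ Torus) (H : ClosedAddSubgroup Torus) :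
    shiftMap (H.mapAut (consAut g)) = (shiftMap H).mapAut g := by
  refine SetLike.ext fun z => ?_
  constructor
  · rintro ⟨_, ⟨y, hy, rfl⟩, rfl⟩
    exact ⟨_, ⟨y, hy, rfl⟩, (shiftHom_consAut g y).symm⟩
  · rintro ⟨_, ⟨y, hy, rfl⟩, rfl⟩
    exact ⟨_, ⟨y, hy, rfl⟩, shiftHom_consAut g y⟩

theorem mapAut_consAut_mem_perp_zero (g : Torus ≃ₜ+ Torus) (a : ℤ)
    (H : ClosedAddSubgroup Torus) :
    H.mapAut (consAut g) ∈ perp (Finsupp.single 0 a) ↔ H ∈ perp (Finsupp.single 0 a) := by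
  constructor
  · intro h y hy
    have := h (consAut g y) ⟨y, hy, rfl⟩
    rwa [pairing_single, consAut_zero, ← pairing_single] at this
  · rintro h _ ⟨y, hy, rfl⟩
    change pairing _ (consAut g y) = 0
    rw [pairing_single, consAut_zero, ← pairing_single]
    exact h y hy

/-! ### Diagonal events -/

/-- The closed subgroups annihilated by the vectors `lᵢ eᵢ`. -/
def diagSet (l : List ℕ) : Set (ClosedAddSubgroup Torus) :=
  {H | ∀ i, H ∈ perp (Finsupp.single i ((l.getD i 0 : ℕ) : ℤ))}

theorem perp_zero : perp 0 = Set.univ := by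
  ext H
  simp [← mem_annihilator, zero_mem]

/-- Past the end of the list the default entry `0` yields the zero vector, which imposes no
condition, so only finitely many clopen sets are intersected. -/
theorem isClopen_diagSet (l : List ℕ) : IsClopen (diagSet l) := by
  have : diagSet l = ⋂ i ∈ Finset.range l.length,
      perp (Finsupp.single i ((l.getD i 0 : ℕ) : ℤ)) := by
    ext H
    simp only [diagSet, Set.mem_ofPred_eq, Set.mem_iInter, Finset.mem_range]
    refine ⟨fun h i _ => h i, fun h i => ?_⟩
    by_cases hi : i < l.length
    · exact h i hi
    · rw [List.getD_eq_default _ _ (not_lt.1 hi), Nat.cast_zero, Finsupp.single_zero, perp_zero]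
      trivial
  rw [this]
  exact (Finset.range l.length).finite_toSet.isClopen_biInter fun i _ => isClopen_perp _

theorem diagSet_nil : diagSet [] = Set.univ := by
  ext H
  simp [diagSet, perp_zero]

theorem diagSet_cons (d : ℕ) (l : List ℕ) :
    diagSet (d :: l) = perp (Finsupp.single 0 (d : ℤ)) ∩ shiftMap ⁻¹' diagSet l := by
  ext H
  simp only [diagSet, Set.mem_ofPred_eq, Set.mem_inter_iff, Set.mem_preimage, shiftMap_mem_perp,
    Finsupp.mapDomain_single]
  rw [← Nat.and_forall_add_one]
  simp

theorem diagSet_singleton (d : ℕ) : diagSet [d] = perp (Finsupp.single 0 (d : ℤ)) := by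
  rw [diagSet_cons, diagSet_nil, Set.preimage_univ, Set.inter_univ]

/-- The probability that a random subgroup is annihilated by the vectors `lᵢ eᵢ`. -/
def coeff (μ : ProbabilityMeasure (ClosedAddSubgroup Torus)) (l : List ℕ) : ℝ :=
  (μ : Measure (ClosedAddSubgroup Torus)).real (diagSet l)

theorem coeff_nil (μ : ProbabilityMeasure (ClosedAddSubgroup Torus)) : coeff μ [] = 1 := by
  simp [coeff, diagSet_nil]

/-! ### Smith normal form -/

/-- The vectors of `B` lie in some `ℤ^N`, and Smith normal form of their span there gives a change
of basis of `ℤ^N`, extended by the identity to the other coordinates. Quantifying over all `Λ` says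
that `α(B)` and the vectors `lᵢ eᵢ` generate the same subgroup. Divisibility between successive
entries is not needed. -/
theorem exists_aut_diagonal (B : Finset (ℕ →₀ ℤ)) :
    ∃ (α : (ℕ →₀ ℤ) ≃+ (ℕ →₀ ℤ)) (l : List ℕ), ∀ Λ : AddSubgroup (ℕ →₀ ℤ),
      (∀ x ∈ B, α x ∈ Λ) ↔ ∀ i, Finsupp.single i ((l.getD i 0 : ℕ) : ℤ) ∈ Λ := by
  obtain ⟨N, hN⟩ : ∃ N, ∀ x ∈ B, ∀ i, N ≤ i → x i = 0 := by
    refine ⟨(B.sup fun x => x.support.sup id) + 1, fun x hx i hi => ?_⟩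
    by_contra hne
    have h1 : i ≤ x.support.sup id := Finset.le_sup (f := id) (Finsupp.mem_support_iff.2 hne)
    have h2 : x.support.sup id ≤ B.sup fun x => x.support.sup id :=
      Finset.le_sup (f := fun x : ℕ →₀ ℤ => x.support.sup id) hx
    omega
  let e : (ℕ →₀ ℤ) ≃ₗ[ℤ] (Fin N →₀ ℤ) × (ℕ →₀ ℤ) :=
    (Finsupp.domLCongr (finSumNatEquiv N).symm).trans (Finsupp.sumFinsuppLEquivProdFinsupp ℤ)
  have he2 : ∀ x ∈ B, (e x).2 = 0 := by
    intro x hx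
    ext i
    simp only [e, LinearEquiv.trans_apply, Finsupp.snd_sumFinsuppLEquivProdFinsupp,
      Finsupp.domLCongr_apply, Finsupp.domCongr_apply, Finsupp.equivMapDomain_apply,
      Equiv.symm_symm, finSumNatEquiv_apply_right, Finsupp.coe_zero, Pi.zero_apply]
    exact hN x hx _ (Nat.le_add_right _ _)
  have hes : ∀ (i : Fin N) (a : ℤ),
      e.symm (Finsupp.single i a, 0) = Finsupp.single (i : ℕ) a := by
    intro i a
    rw [LinearEquiv.symm_apply_eq]
    simp only [e, LinearEquiv.trans_apply, Finsupp.domLCongr_single]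
    rw [finSumNatEquiv_symm_apply_fin]
    ext j <;> simp
  let N' : Submodule ℤ (Fin N →₀ ℤ) := Submodule.span ℤ ((fun x => (e x).1) '' (B : Set (ℕ →₀ ℤ)))
  obtain ⟨n, bM, bN, f, a, snf⟩ := N'.smithNormalForm Finsupp.basisSingleOne
  let α : (ℕ →₀ ℤ) ≃ₗ[ℤ] (ℕ →₀ ℤ) :=
    e.trans ((bM.repr.prodCongr (LinearEquiv.refl ℤ (ℕ →₀ ℤ))).trans e.symm)
  let ι : (Fin N →₀ ℤ) →ₗ[ℤ] (ℕ →₀ ℤ) :=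
    e.symm.toLinearMap ∘ₗ LinearMap.inl ℤ _ _ ∘ₗ bM.repr.toLinearMap
  have hα : ∀ x ∈ B, α x = ι (e x).1 := by
    intro x hx
    simp [α, ι, he2 x hx, LinearEquiv.prodCongr_apply]
  have hι : ∀ i, ι (bN i : Fin N →₀ ℤ) = Finsupp.single (f i : ℕ) (a i) := by
    intro i
    rw [snf, map_smul]
    simp [ι, hes]
  have hspan : N' = Submodule.span ℤ (Set.range fun i => (bN i : Fin N →₀ ℤ)) := by
    have := congrArg (Submodule.map N'.subtype) bN.span_eq
    rw [Submodule.map_span, Submodule.map_subtype_top, ← Set.range_comp] at this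
    exact this.symm
  classical
  -- The span may have rank less than `N`; coordinates outside the range of `f` get the entry `0`,
  -- that is, no condition. Signs are dropped because `Λ` is closed under negation.
  let d : Fin N → ℕ := fun j => if h : ∃ i, f i = j then (a h.choose).natAbs else 0
  have hd : ∀ i, d (f i) = (a i).natAbs := by
    intro i
    have h : ∃ i', f i' = f i := ⟨i, rfl⟩
    simp only [d, dif_pos h]
    rw [f.injective h.choose_spec]
  refine ⟨α.toAddEquiv, List.ofFn d, fun Λ => ?_⟩
  let L : Submodule ℤ (Fin N →₀ ℤ) := Submodule.comap ι (AddSubgroup.toIntSubmodule Λ)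
  have h1 : (∀ x ∈ B, α.toAddEquiv x ∈ Λ) ↔ N' ≤ L := by
    rw [Submodule.span_le, Set.image_subset_iff]
    refine forall₂_congr fun x hx => ?_
    change α x ∈ Λ ↔ ι (e x).1 ∈ Λ
    rw [hα x hx]
  have h2 : N' ≤ L ↔ ∀ i, Finsupp.single (f i : ℕ) (a i) ∈ Λ := by
    rw [hspan, Submodule.span_le, Set.range_subset_iff]
    refine forall_congr' fun i => ?_
    rw [← hι]
    rfl
  rw [h1, h2]
  have hnat : ∀ (j : ℕ) (b : ℤ), Finsupp.single j ((b.natAbs : ℕ) : ℤ) ∈ Λ ↔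
      Finsupp.single j b ∈ Λ := by
    intro j b
    rcases Int.natAbs_eq b with h | h
    · rw [← h]
    · conv_rhs => rw [h, Finsupp.single_neg, neg_mem_iff]
  constructor
  · intro h j
    by_cases hj : j < N
    · have : (List.ofFn d).getD j 0 = d ⟨j, hj⟩ := by
        rw [List.getD_eq_getElem _ _ (by simpa using hj)]
        simp
      rw [this]
      by_cases hex : ∃ i, f i = ⟨j, hj⟩
      · obtain ⟨i, hi⟩ := hex
        rw [← hi, hd, hnat]
        simpa [hi] using h i
      · simp [d, dif_neg hex, zero_mem]
    · rw [List.getD_eq_default _ _ (by simpa using hj)]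
      simp [zero_mem]
  · intro h i
    have h3 := h (f i)
    have : (List.ofFn d).getD (f i) 0 = d (f i) := by
      rw [List.getD_eq_getElem _ _ (by simp)]
      simp
    rwa [this, hd, hnat] at h3

/-! ### Characteristic random subgroups and their diagonal coefficients -/

theorem CRS.measure_preimage {μ : ProbabilityMeasure (ClosedAddSubgroup Torus)}
    (hμ : μ ∈ CRS Torus) (φ : Torus ≃ₜ+ Torus) {s : Set (ClosedAddSubgroup Torus)}
    (hs : MeasurableSet s) :
    (μ : Measure (ClosedAddSubgroup Torus)) (ClosedAddSubgroup.mapAut φ ⁻¹' s) =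
      (μ : Measure (ClosedAddSubgroup Torus)) s := by
  conv_rhs => rw [← hμ φ]
  rw [Measure.map_apply (ClosedAddSubgroup.continuous_mapAut φ).measurable hs]

/-- The list depends on `B` alone, so one reduction serves several random subgroups at once, even a
whole family under an integral. -/
theorem CRS.exists_measure_perpFinset (B : Finset (ℕ →₀ ℤ)) :
    ∃ l, ∀ μ ∈ CRS Torus,
      (μ : Measure (ClosedAddSubgroup Torus)) (perpFinset B) =
        (μ : Measure (ClosedAddSubgroup Torus)) (diagSet l) := by
  obtain ⟨α, l, h⟩ := exists_aut_diagonal B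
  refine ⟨l, fun μ hμ => ?_⟩
  rw [← CRS.measure_preimage hμ (dualAut α) (isClopen_perpFinset B).isOpen.measurableSet]
  congr 1
  ext H
  simp only [Set.mem_preimage, mem_perpFinset, mapAut_dualAut_mem_perp]
  exact h (annihilator H)

/-- A characteristic random subgroup is determined by its diagonal coefficients. -/
theorem CRS.ext_coeff {μ ν : ProbabilityMeasure (ClosedAddSubgroup Torus)} (hμ : μ ∈ CRS Torus)
    (hν : ν ∈ CRS Torus) (h : coeff μ = coeff ν) : μ = ν := by
  refine ProbabilityMeasure.toMeasure_injective (measure_ext_of_perpFinset _ _ fun B => ?_)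
  obtain ⟨l, hl⟩ := CRS.exists_measure_perpFinset B
  have h1 := hl μ hμ
  have h2 := hl ν hν
  have h3 := congrFun h l
  rw [coeff, coeff, measureReal_eq_measureReal_iff] at h3
  exact h1.trans (h3.trans h2.symm)

/-- The entry `0` imposes no condition and merely moves the other vectors one index up, which a
permutation of the basis undoes. In effect the shifted random subgroup has the same coefficients. -/
theorem CRS.coeff_zero_cons {μ : ProbabilityMeasure (ClosedAddSubgroup Torus)}
    (hμ : μ ∈ CRS Torus) (l : List ℕ) : coeff μ (0 :: l) = coeff μ l := by
  -- The successor map is not a bijection of `ℕ`; a permutation agreeing with it on the indices in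
  -- use exists by multiple transitivity.
  obtain ⟨σ, hσ⟩ : ∃ σ : Equiv.Perm ℕ, ∀ i < l.length, σ i = i + 1 := by
    have := (Equiv.Perm.isMultiplyPretransitive ℕ l.length).exists_smul_eq
      (Fin.valEmbedding) (Fin.valEmbedding.trans ⟨Nat.succ, Nat.succ_injective⟩)
    obtain ⟨σ, h⟩ := this
    exact ⟨σ, fun i hi => DFunLike.congr_fun h ⟨i, hi⟩⟩
  rw [coeff, coeff, measureReal_def, measureReal_def]
  congr 1
  rw [← CRS.measure_preimage hμ (dualAut (Finsupp.domCongr σ)) (isClopen_diagSet l).isOpen.measurableSet]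
  congr 1
  ext H
  simp only [diagSet, Set.mem_preimage, Set.mem_ofPred_eq, mapAut_dualAut_mem_perp]
  rw [← Nat.and_forall_add_one]
  simp only [List.getD_cons_zero, Nat.cast_zero, Finsupp.single_zero, perp_zero, Set.mem_univ,
    true_and, List.getD_cons_succ, Finsupp.domCongr_apply, Finsupp.equivMapDomain_single]
  refine forall_congr' fun i => ?_
  by_cases hi : i < l.length
  · rw [hσ i hi]
  · rw [List.getD_eq_default _ _ (not_lt.1 hi)]
    simp

/-- Conditioning on an event that depends on the zeroth coordinate only and forgetting that
coordinate gives a characteristic random subgroup. -/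
theorem CRS.exists_cond_shift {μ : ProbabilityMeasure (ClosedAddSubgroup Torus)}
    (hμ : μ ∈ CRS Torus) {T : Set (ClosedAddSubgroup Torus)} (hT : MeasurableSet T)
    (hinv : ∀ g, ClosedAddSubgroup.mapAut (consAut g) ⁻¹' T = T)
    (h0 : (μ : Measure (ClosedAddSubgroup Torus)).real T ≠ 0) :
    ∃ ν ∈ CRS Torus, ∀ l, coeff ν l =
      (μ : Measure (ClosedAddSubgroup Torus)).real (T ∩ shiftMap ⁻¹' diagSet l) /
        (μ : Measure (ClosedAddSubgroup Torus)).real T := by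
  have h0' : (μ : Measure (ClosedAddSubgroup Torus)) T ≠ 0 := fun h => h0 (by simp [measureReal_def, h])
  have hms : Measurable shiftMap := continuous_shiftMap.measurable
  let m := ((μ : Measure (ClosedAddSubgroup Torus)) T)⁻¹ •
    ((μ : Measure (ClosedAddSubgroup Torus)).restrict T).map shiftMap
  have hm : IsProbabilityMeasure m := ⟨by
    simp only [m, Measure.smul_apply, Measure.map_apply hms MeasurableSet.univ, Set.preimage_univ,
      Measure.restrict_apply_univ, smul_eq_mul]
    exact ENNReal.inv_mul_cancel h0' (measure_ne_top _ _)⟩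
  refine ⟨⟨m, hm⟩, fun g => ?_, fun l => ?_⟩
  · have hg : Measurable (ClosedAddSubgroup.mapAut g) :=
      (ClosedAddSubgroup.continuous_mapAut g).measurable
    have hcg : Measurable (ClosedAddSubgroup.mapAut (consAut g)) :=
      (ClosedAddSubgroup.continuous_mapAut (consAut g)).measurable
    change m.map _ = m
    simp only [m, Measure.map_smul]
    congr 1
    rw [Measure.map_map hg hms]
    have : ClosedAddSubgroup.mapAut g ∘ shiftMap =
        shiftMap ∘ ClosedAddSubgroup.mapAut (consAut g) :=
      funext fun H => (shiftMap_mapAut_consAut g H).symm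
    rw [this, ← Measure.map_map hms hcg]
    congr 1
    -- Since `T` is invariant under `consAut g`, restricting to `T` commutes with pushing forward,
    -- and the invariance of `μ` applies.
    conv_lhs => rw [← hinv g]
    rw [← Measure.restrict_map hcg hT, hμ]
  · change m.real _ = _
    simp only [m, measureReal_def, Measure.smul_apply, smul_eq_mul, ENNReal.toReal_mul,
      ENNReal.toReal_inv]
    rw [Measure.map_apply hms (isClopen_diagSet l).isOpen.measurableSet,
      Measure.restrict_apply (hms (isClopen_diagSet l).isOpen.measurableSet), Set.inter_comm, div_eq_inv_mul]

/-- A random subgroup whose diagonal events are independent. -/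
def IsMultiplicative (μ : ProbabilityMeasure (ClosedAddSubgroup Torus)) : Prop :=
  ∀ d l, coeff μ (d :: l) = coeff μ [d] * coeff μ l

theorem IsMultiplicative.coeff_eq {μ : ProbabilityMeasure (ClosedAddSubgroup Torus)}
    (h : IsMultiplicative μ) (l : List ℕ) : coeff μ l = (l.map fun d => coeff μ [d]).prod := by
  induction l with
  | nil => simp [coeff_nil]
  | cons d l ih => rw [h, ih, List.map_cons, List.prod_cons]

/-- Indecomposability forces the diagonal events to be independent. -/
theorem CRS.isMultiplicative_of_extreme {μ : ProbabilityMeasure (ClosedAddSubgroup Torus)}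
    (hμ : μ ∈ CRS Torus)
    (hext : ∀ μ₁ ∈ CRS Torus, ∀ μ₂ ∈ CRS Torus, ∀ p : ℝ, 0 < p → p < 1 →
      (∀ l, p * coeff μ₁ l + (1 - p) * coeff μ₂ l = coeff μ l) → coeff μ₁ = coeff μ) :
    IsMultiplicative μ := by
  intro d l
  set m := (μ : Measure (ClosedAddSubgroup Torus)) with hm
  set S := perp (Finsupp.single 0 (d : ℤ)) with hS
  have hSm : MeasurableSet S := (isClopen_perp _).isOpen.measurableSet
  have hinv : ∀ g, ClosedAddSubgroup.mapAut (consAut g) ⁻¹' S = S := fun g => by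
    ext H
    exact mapAut_consAut_mem_perp_zero g d H
  have hinv' : ∀ g, ClosedAddSubgroup.mapAut (consAut g) ⁻¹' Sᶜ = Sᶜ := fun g => by
    rw [Set.preimage_compl, hinv]
  have hd : coeff μ [d] = m.real S := by rw [coeff, diagSet_singleton]
  have hdl : ∀ l, coeff μ (d :: l) = m.real (S ∩ shiftMap ⁻¹' diagSet l) := fun l => by
    rw [coeff, diagSet_cons]
  have hsum : ∀ l, m.real (S ∩ shiftMap ⁻¹' diagSet l) + m.real (Sᶜ ∩ shiftMap ⁻¹' diagSet l) =
      coeff μ l := by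
    intro l
    rw [← CRS.coeff_zero_cons hμ, coeff, diagSet_cons]
    simp only [Nat.cast_zero, Finsupp.single_zero, perp_zero, Set.univ_inter]
    rw [Set.inter_comm, Set.inter_comm Sᶜ, ← Set.sdiff_eq]
    exact measureReal_inter_add_sdiff hSm
  have hcompl : m.real Sᶜ = 1 - m.real S := probReal_compl_eq_one_sub hSm
  rw [hdl, hd]
  -- Conditioning needs `S` and its complement to have positive probability; in the degenerate cases
  -- independence is immediate.
  by_cases h0 : m.real S = 0
  · rw [h0, zero_mul]
    exact le_antisymm ((measureReal_mono Set.inter_subset_left).trans h0.le) measureReal_nonneg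
  by_cases h1 : m.real Sᶜ = 0
  · have h2 : m.real (Sᶜ ∩ shiftMap ⁻¹' diagSet l) = 0 :=
      le_antisymm ((measureReal_mono Set.inter_subset_left).trans h1.le) measureReal_nonneg
    have h3 : m.real S = 1 := by linarith
    rw [h3, one_mul, ← hsum l, h2, add_zero]
  -- The two conditioned and shifted laws average to the coefficients of `μ`. By indecomposability
  -- conditioning on `S` changes no coefficient, which is independence of `S` from the later
  -- coordinates.
  obtain ⟨ν₁, hν₁, hc₁⟩ := CRS.exists_cond_shift hμ hSm hinv h0
  obtain ⟨ν₂, hν₂, hc₂⟩ := CRS.exists_cond_shift hμ hSm.compl hinv' h1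
  have hp : 0 < m.real S := lt_of_le_of_ne measureReal_nonneg (Ne.symm h0)
  have hp' : 0 < m.real Sᶜ := lt_of_le_of_ne measureReal_nonneg (Ne.symm h1)
  have := hext ν₁ hν₁ ν₂ hν₂ (m.real S) hp (by linarith) (fun l => by
    rw [hc₁, hc₂, ← hcompl, ← hm, mul_div_cancel₀ _ h0, mul_div_cancel₀ _ h1, hsum])
  rw [← this, hc₁, ← hm, mul_div_cancel₀ _ h0]

/-! ### Spaces of probability measures -/

theorem polishSpace_of_compact_metrizable (X : Type*) [TopologicalSpace X] [CompactSpace X]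
    [TopologicalSpace.MetrizableSpace X] : PolishSpace X := by
  let _ := TopologicalSpace.metrizableSpaceMetric X
  infer_instance

section General

variable {X : Type*} [MeasurableSpace X]

/-- The convex combination `a μ + b ν` of probability measures. -/
def mixMeasure (a b : ℝ≥0) (h : a + b = 1) (μ ν : ProbabilityMeasure X) : ProbabilityMeasure X :=
  ⟨a • (μ : Measure X) + b • (ν : Measure X), ⟨by
    simp only [Measure.add_apply, Measure.smul_apply, measure_univ]
    rw [ENNReal.smul_def, ENNReal.smul_def, smul_eq_mul, smul_eq_mul, mul_one, mul_one]
    exact_mod_cast h⟩⟩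

theorem coe_mixMeasure (a b : ℝ≥0) (h : a + b = 1) (μ ν : ProbabilityMeasure X) :
    (mixMeasure a b h μ ν : Measure X) = a • (μ : Measure X) + b • (ν : Measure X) := rfl

theorem integral_mixMeasure (a b : ℝ≥0) (h : a + b = 1) (μ ν : ProbabilityMeasure X) {f : X → ℝ}
    (hμ : Integrable f (μ : Measure X)) (hν : Integrable f (ν : Measure X)) :
    ∫ x, f x ∂(mixMeasure a b h μ ν : Measure X) =
      a * ∫ x, f x ∂(μ : Measure X) + b * ∫ x, f x ∂(ν : Measure X) := by
  rw [coe_mixMeasure, integral_add_measure, integral_smul_nnreal_measure,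
    integral_smul_nnreal_measure]
  · rfl
  · exact hμ.smul_measure ENNReal.coe_ne_top
  · exact hν.smul_measure ENNReal.coe_ne_top

theorem measureReal_mix (a b : ℝ≥0) (μ ν : Measure X) [IsFiniteMeasure μ] [IsFiniteMeasure ν]
    (s : Set X) : (a • μ + b • ν).real s = a * μ.real s + b * ν.real s := by
  rw [measureReal_add_apply, measureReal_nnreal_smul_apply, measureReal_nnreal_smul_apply]

/-- The indicator of a clopen set is a continuous test function. -/
theorem continuous_measureReal_of_isClopen [TopologicalSpace X] [OpensMeasurableSpace X]
    {s : Set X} (hs : IsClopen s) :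
    Continuous fun μ : ProbabilityMeasure X => (μ : Measure X).real s := by
  convert ProbabilityMeasure.continuous_integral_boundedContinuousFunction
    (BoundedContinuousFunction.indicator s hs) using 2 with μ
  exact (integral_indicator_one hs.isOpen.measurableSet).symm

end General

/-- The probabilities of the basic events, as an embedding of the space of random subgroups. -/
def perpProb (μ : ProbabilityMeasure (ClosedAddSubgroup Torus)) (B : Finset (ℕ →₀ ℤ)) : ℝ :=
  (μ : Measure (ClosedAddSubgroup Torus)).real (perpFinset B)

theorem continuous_perpProb : Continuous perpProb :=
  continuous_pi fun B => continuous_measureReal_of_isClopen (isClopen_perpFinset B)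

theorem perpProb_injective : Function.Injective perpProb := by
  intro μ ν h
  refine ProbabilityMeasure.toMeasure_injective (measure_ext_of_perpFinset _ _ fun B => ?_)
  have := congrFun h B
  rwa [perpProb, perpProb, measureReal_eq_measureReal_iff] at this

theorem isClosedEmbedding_perpProb : IsClosedEmbedding perpProb :=
  continuous_perpProb.isClosedEmbedding perpProb_injective

instance : TopologicalSpace.MetrizableSpace (ProbabilityMeasure (ClosedAddSubgroup Torus)) :=
  isClosedEmbedding_perpProb.isEmbedding.metrizableSpace

/-- Evaluations on the π-system `perpFinset` generate both σ-algebras: they are continuous, and they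
embed the space in a countable power of `ℝ`, where the Borel and product σ-algebras agree.
Representing measures are thereby genuine Borel measures. -/
instance : BorelSpace (ProbabilityMeasure (ClosedAddSubgroup Torus)) := by
  refine ⟨le_antisymm ?_ ?_⟩
  · refine MeasurableSpace.comap_le_iff_le_map.2 ?_
    let _ : MeasurableSpace (ProbabilityMeasure (ClosedAddSubgroup Torus)) := borel _
    have : BorelSpace (ProbabilityMeasure (ClosedAddSubgroup Torus)) := ⟨rfl⟩
    have hm : Measurable
        fun μ : ProbabilityMeasure (ClosedAddSubgroup Torus) =>
          (μ : Measure (ClosedAddSubgroup Torus)) := by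
      refine Measurable.measure_of_isPiSystem_of_isProbabilityMeasure generateFrom_perpFinset
        isPiSystem_perpFinset ?_
      rintro _ ⟨B, rfl⟩
      have := (continuous_measureReal_of_isClopen
        (isClopen_perpFinset B)).measurable.ennreal_ofReal
      have e : (fun μ : ProbabilityMeasure (ClosedAddSubgroup Torus) =>
          ENNReal.ofReal ((μ : Measure (ClosedAddSubgroup Torus)).real (perpFinset B))) =
          fun μ : ProbabilityMeasure (ClosedAddSubgroup Torus) =>
            (μ : Measure (ClosedAddSubgroup Torus)) (perpFinset B) :=
        funext fun μ => ofReal_measureReal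
      rwa [e] at this
    exact hm.le_map
  · have h1 : borel (ProbabilityMeasure (ClosedAddSubgroup Torus)) =
        MeasurableSpace.comap perpProb (borel (Finset (ℕ →₀ ℤ) → ℝ)) := by
      rw [← borel_comap, ← isClosedEmbedding_perpProb.isInducing.eq_induced]
    rw [h1, ← (inferInstance : BorelSpace (Finset (ℕ →₀ ℤ) → ℝ)).measurable_eq]
    refine measurable_iff_comap_le.1 (measurable_pi_iff.2 fun B => ?_)
    exact ((Measure.measurable_coe (isClopen_perpFinset B).isOpen.measurableSet).comp
      measurable_subtype_coe).ennreal_toReal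

/-! ### The compact convex set of characteristic random subgroups -/

theorem continuous_coeff : Continuous coeff :=
  continuous_pi fun l => continuous_measureReal_of_isClopen (isClopen_diagSet l)

theorem continuous_coeff_apply (l : List ℕ) :
    Continuous fun μ : ProbabilityMeasure (ClosedAddSubgroup Torus) => coeff μ l :=
  continuous_measureReal_of_isClopen (isClopen_diagSet l)

theorem coeff_nonneg (μ : ProbabilityMeasure (ClosedAddSubgroup Torus)) (l : List ℕ) :
    0 ≤ coeff μ l := measureReal_nonneg

theorem isClosed_CRS : IsClosed (CRS Torus) := by
  have : CRS Torus = ⋂ φ : Torus ≃ₜ+ Torus, {μ : ProbabilityMeasure (ClosedAddSubgroup Torus) |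
      μ.map (ClosedAddSubgroup.continuous_mapAut φ).measurable.aemeasurable = μ} := by
    ext μ
    simp only [CRS, Set.mem_ofPred_eq, Set.mem_iInter]
    exact forall_congr' fun φ => ⟨fun h => ProbabilityMeasure.toMeasure_injective h,
      fun h => congrArg ProbabilityMeasure.toMeasure h⟩
  rw [this]
  exact isClosed_iInter fun φ => isClosed_eq
    (ProbabilityMeasure.continuous_map (ClosedAddSubgroup.continuous_mapAut φ)) continuous_id

theorem mixMeasure_mem_CRS (a b : ℝ≥0) (h : a + b = 1)
    {μ ν : ProbabilityMeasure (ClosedAddSubgroup Torus)} (hμ : μ ∈ CRS Torus)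
    (hν : ν ∈ CRS Torus) : mixMeasure a b h μ ν ∈ CRS Torus := by
  intro φ
  rw [coe_mixMeasure, Measure.map_add _ _ (ClosedAddSubgroup.continuous_mapAut φ).measurable,
    Measure.map_smul, Measure.map_smul, hμ, hν]

theorem coeff_mixMeasure (a b : ℝ≥0) (h : a + b = 1)
    (μ ν : ProbabilityMeasure (ClosedAddSubgroup Torus)) (l : List ℕ) :
    coeff (mixMeasure a b h μ ν) l = a * coeff μ l + b * coeff ν l :=
  measureReal_mix _ _ _ _ _

/-- The characteristic random subgroups with independent diagonal events. -/
def multiplicativeCRS : Set (ProbabilityMeasure (ClosedAddSubgroup Torus)) :=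
  {μ | μ ∈ CRS Torus ∧ IsMultiplicative μ}

/-- Independence is a family of equations between continuous coefficients; this is what finally
makes the extreme boundary closed. -/
theorem isClosed_multiplicativeCRS : IsClosed multiplicativeCRS := by
  have : multiplicativeCRS = CRS Torus ∩ ⋂ d : ℕ, ⋂ l : List ℕ,
      {μ | coeff μ (d :: l) = coeff μ [d] * coeff μ l} := by
    ext μ
    simp [multiplicativeCRS, IsMultiplicative]
  rw [this]
  exact isClosed_CRS.inter (isClosed_iInter fun d => isClosed_iInter fun l =>
    isClosed_eq (continuous_coeff_apply _)
      ((continuous_coeff_apply _).mul (continuous_coeff_apply _)))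

theorem IsMultiplicative.coeff_append {μ : ProbabilityMeasure (ClosedAddSubgroup Torus)}
    (h : IsMultiplicative μ) (l l' : List ℕ) : coeff μ (l ++ l') = coeff μ l * coeff μ l' := by
  rw [h.coeff_eq, h.coeff_eq l, h.coeff_eq l', List.map_append, List.prod_append]

instance : CompactSpace multiplicativeCRS :=
  isCompact_iff_compactSpace.1 isClosed_multiplicativeCRS.isCompact

/-- The diagonal coefficients as bounded continuous functions. -/
def coeffFun (l : List ℕ) : BoundedContinuousFunction multiplicativeCRS ℝ :=
  BoundedContinuousFunction.mkOfCompact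
    ⟨fun ν => coeff ν.1 l, (continuous_coeff_apply l).comp continuous_subtype_val⟩

theorem integrable_coeff (ω : Measure multiplicativeCRS) [IsFiniteMeasure ω] (l : List ℕ) :
    Integrable (fun ν : multiplicativeCRS => coeff ν.1 l) ω :=
  (coeffFun l).integrable ω

/-- The diagonal coefficients of the barycenter of a measure on `multiplicativeCRS`. -/
def barycenterCoeff (ω : ProbabilityMeasure multiplicativeCRS) (l : List ℕ) : ℝ :=
  ∫ ν : multiplicativeCRS, coeff ν.1 l ∂(ω : Measure multiplicativeCRS)

theorem continuous_barycenterCoeff : Continuous barycenterCoeff :=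
  continuous_pi fun l =>
    ProbabilityMeasure.continuous_integral_boundedContinuousFunction (coeffFun l)

/-! ### Krein–Milman representation by multiplicative random subgroups -/

theorem convex_range_barycenterCoeff : Convex ℝ (Set.range barycenterCoeff) := by
  rintro _ ⟨ω₁, rfl⟩ _ ⟨ω₂, rfl⟩ a b ha hb hab
  lift a to ℝ≥0 using ha
  lift b to ℝ≥0 using hb
  refine ⟨mixMeasure a b (by exact_mod_cast hab) ω₁ ω₂, ?_⟩
  ext l
  exact integral_mixMeasure _ _ _ _ _ (integrable_coeff _ l) (integrable_coeff _ l)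

theorem convex_coeff_CRS : Convex ℝ (coeff '' CRS Torus) := by
  rintro _ ⟨μ₁, h₁, rfl⟩ _ ⟨μ₂, h₂, rfl⟩ a b ha hb hab
  lift a to ℝ≥0 using ha
  lift b to ℝ≥0 using hb
  refine ⟨_, mixMeasure_mem_CRS a b (by exact_mod_cast hab) h₁ h₂, ?_⟩
  ext l
  exact coeff_mixMeasure _ _ _ _ _ l

/-- Krein–Milman for the compact convex set of coefficient families: its extreme points come from
multiplicative CRS, which are represented by point masses, and the set of barycenters is compact and
convex, so it contains their closed convex hull. -/
theorem coeff_CRS_subset_range : coeff '' CRS Torus ⊆ Set.range barycenterCoeff := by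
  have hK : IsCompact (coeff '' CRS Torus) := isClosed_CRS.isCompact.image continuous_coeff
  rw [← closure_convexHull_extremePoints hK convex_coeff_CRS]
  refine closure_minimal (convexHull_min ?_ convex_range_barycenterCoeff)
    (isCompact_range continuous_barycenterCoeff).isClosed
  rintro _ ⟨⟨μ, hμ, rfl⟩, hext⟩
  have hmul : IsMultiplicative μ := by
    refine CRS.isMultiplicative_of_extreme hμ fun μ₁ h₁ μ₂ h₂ p hp hp' h => ?_
    refine hext ⟨μ₁, h₁, rfl⟩ ⟨μ₂, h₂, rfl⟩ ⟨p, 1 - p, hp, by linarith, by ring, ?_⟩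
    ext l
    exact h l
  refine ⟨⟨Measure.dirac ⟨μ, hμ, hmul⟩, inferInstance⟩, ?_⟩
  ext l
  exact integral_dirac _ _

theorem CRS.exists_barycenterCoeff_eq {μ : ProbabilityMeasure (ClosedAddSubgroup Torus)}
    (hμ : μ ∈ CRS Torus) : ∃ ω, barycenterCoeff ω = coeff μ :=
  coeff_CRS_subset_range ⟨μ, hμ, rfl⟩

/-- On multiplicative `ν` the square of `coeff ν [d]` is `coeff ν [d, d]`, so the second moment
under `ω` is itself a coefficient of the barycenter. For fixed `k` the right side is affine in `μ`.
-/
theorem CRS.integral_sq_sub {μ : ProbabilityMeasure (ClosedAddSubgroup Torus)}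
    {ω : ProbabilityMeasure multiplicativeCRS} (h : barycenterCoeff ω = coeff μ) (d : ℕ) (k : ℝ) :
    ∫ ν : multiplicativeCRS, (coeff ν.1 [d] - k) ^ 2 ∂(ω : Measure multiplicativeCRS) =
      coeff μ [d, d] - 2 * k * coeff μ [d] + k ^ 2 := by
  have e : ∀ ν : multiplicativeCRS,
      (coeff ν.1 [d] - k) ^ 2 = coeff ν.1 [d, d] - 2 * k * coeff ν.1 [d] + k ^ 2 := by
    intro ν
    rw [ν.2.2 d [d]]
    ring
  simp only [e]
  have i₁ : Integrable (fun ν : multiplicativeCRS => 2 * k * coeff ν.1 [d])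
      (ω : Measure multiplicativeCRS) := (integrable_coeff _ _).const_mul _
  have i₂ : Integrable (fun ν : multiplicativeCRS => coeff ν.1 [d, d] - 2 * k * coeff ν.1 [d])
      (ω : Measure multiplicativeCRS) := (integrable_coeff _ _).sub i₁
  rw [integral_add i₂ (integrable_const _), integral_sub (integrable_coeff _ _) i₁,
    integral_const_mul, ← h]
  simp [barycenterCoeff]

/-- Characteristic random subgroups with independent diagonal events are indecomposable. -/
theorem IsMultiplicative.coeff_eq_of_mix {μ μ₁ μ₂ : ProbabilityMeasure (ClosedAddSubgroup Torus)}
    (hμ : IsMultiplicative μ) (h₁ : μ₁ ∈ CRS Torus) (h₂ : μ₂ ∈ CRS Torus) {a b : ℝ} (ha : 0 < a)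
    (hb : 0 < b) (hab : a + b = 1) (h : ∀ l, a * coeff μ₁ l + b * coeff μ₂ l = coeff μ l) :
    coeff μ₁ = coeff μ := by
  obtain ⟨ω₁, hω₁⟩ := CRS.exists_barycenterCoeff_eq h₁
  obtain ⟨ω₂, hω₂⟩ := CRS.exists_barycenterCoeff_eq h₂
  have hae : ∀ d, ∀ᵐ ν : multiplicativeCRS ∂(ω₁ : Measure multiplicativeCRS),
      coeff ν.1 [d] = coeff μ [d] := by
    intro d
    have i₁ := CRS.integral_sq_sub hω₁ d (coeff μ [d])
    have i₂ := CRS.integral_sq_sub hω₂ d (coeff μ [d])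
    have p₁ : 0 ≤ ∫ ν : multiplicativeCRS, (coeff ν.1 [d] - coeff μ [d]) ^ 2
      ∂(ω₁ : Measure multiplicativeCRS) := integral_nonneg fun _ => sq_nonneg _
    have p₂ : 0 ≤ ∫ ν : multiplicativeCRS, (coeff ν.1 [d] - coeff μ [d]) ^ 2
      ∂(ω₂ : Measure multiplicativeCRS) := integral_nonneg fun _ => sq_nonneg _
    -- With `c = coeff μ [d]`, the mixture of the two second moments about `c` is `coeff μ [d, d] -
    -- 2c² + c²`, which vanishes as `μ` is multiplicative. Both terms are nonnegative, so each is
    -- zero.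
    have hz : a * ∫ ν : multiplicativeCRS, (coeff ν.1 [d] - coeff μ [d]) ^ 2
          ∂(ω₁ : Measure multiplicativeCRS) +
        b * ∫ ν : multiplicativeCRS, (coeff ν.1 [d] - coeff μ [d]) ^ 2
          ∂(ω₂ : Measure multiplicativeCRS) = 0 := by
      rw [i₁, i₂]
      have e1 := h [d]
      have e2 := h [d, d]
      rw [hμ d [d]] at e2
      linear_combination e2 - 2 * coeff μ [d] * e1 + coeff μ [d] ^ 2 * hab
    have hz₁ : ∫ ν : multiplicativeCRS, (coeff ν.1 [d] - coeff μ [d]) ^ 2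
        ∂(ω₁ : Measure multiplicativeCRS) = 0 := by
      nlinarith [mul_nonneg ha.le p₁, mul_nonneg hb.le p₂]
    have hint : Integrable (fun ν : multiplicativeCRS => (coeff ν.1 [d] - coeff μ [d]) ^ 2)
        (ω₁ : Measure multiplicativeCRS) :=
      ((coeffFun [d] - BoundedContinuousFunction.const _ (coeff μ [d])) ^ 2).integrable _
    rw [integral_eq_zero_iff_of_nonneg (fun _ => sq_nonneg _) hint] at hz₁
    filter_upwards [hz₁] with ν hν
    exact sub_eq_zero.1 (pow_eq_zero_iff two_ne_zero |>.1 hν)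
  ext l
  rw [← hω₁]
  have : ∀ᵐ ν : multiplicativeCRS ∂(ω₁ : Measure multiplicativeCRS), coeff ν.1 l = coeff μ l := by
    filter_upwards [ae_all_iff.2 hae] with ν hν
    rw [ν.2.2.coeff_eq, hμ.coeff_eq]
    simp only [hν]
  rw [barycenterCoeff, integral_congr_ae this]
  simp

theorem CRSe_eq_multiplicativeCRS : CRSe Torus = multiplicativeCRS := by
  ext μ
  constructor
  · rintro ⟨⟨μ', hμ', he⟩, hext⟩
    obtain rfl : μ' = μ := ProbabilityMeasure.toMeasure_injective he
    refine ⟨hμ', CRS.isMultiplicative_of_extreme hμ' fun μ₁ h₁ μ₂ h₂ p hp hp' h => ?_⟩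
    have hq : 0 < 1 - p := by linarith
    let a : ℝ≥0 := ⟨p, hp.le⟩
    let b : ℝ≥0 := ⟨1 - p, hq.le⟩
    have hab : a + b = 1 := NNReal.eq (add_sub_cancel p 1)
    have hmix : mixMeasure a b hab μ₁ μ₂ = μ' :=
      CRS.ext_coeff (mixMeasure_mem_CRS a b hab h₁ h₂) hμ' (funext fun l => by
        rw [coeff_mixMeasure]
        exact h l)
    have := hext ⟨μ₁, h₁, rfl⟩ ⟨μ₂, h₂, rfl⟩ ⟨a, b, hp, hq, hab, by rw [← hmix]; rfl⟩
    rw [ProbabilityMeasure.toMeasure_injective this]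
  · rintro ⟨hμ, hmul⟩
    refine ⟨⟨μ, hμ, rfl⟩, ?_⟩
    rintro _ ⟨μ₁, h₁, rfl⟩ _ ⟨μ₂, h₂, rfl⟩ ⟨a, b, ha, hb, hab, h⟩
    have hc : ∀ l, (a : ℝ) * coeff μ₁ l + b * coeff μ₂ l = coeff μ l := by
      intro l
      rw [coeff, coeff, coeff, ← h, measureReal_mix]
    have := hmul.coeff_eq_of_mix h₁ h₂ (NNReal.coe_pos.2 ha) (NNReal.coe_pos.2 hb)
      (by exact_mod_cast hab) hc
    exact congrArg _ (CRS.ext_coeff h₁ hμ this)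

theorem isClosed_CRSe : IsClosed (CRSe Torus) :=
  CRSe_eq_multiplicativeCRS ▸ isClosed_multiplicativeCRS

/-! ### Representing measures -/

/-- The measure `ω` supplied by Krein–Milman matches only diagonal coefficients. Since the reduction
to them is the same for `μ` and for every `ν` in the support, the mixture agrees with `μ` on all
`perpFinset` events, hence is `μ`. -/
theorem CRS.exists_repr {μ : ProbabilityMeasure (ClosedAddSubgroup Torus)} (hμ : μ ∈ CRS Torus) :
    ∃ ω : ProbabilityMeasure (ProbabilityMeasure (ClosedAddSubgroup Torus)),
      (∀ᵐ ν ∂(ω : Measure (ProbabilityMeasure (ClosedAddSubgroup Torus))),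
        ν ∈ multiplicativeCRS) ∧ IsBarycenter ω μ := by
  obtain ⟨ω, hω⟩ := CRS.exists_barycenterCoeff_eq hμ
  have hv : Measurable (Subtype.val : multiplicativeCRS → _) := measurable_subtype_coe
  refine ⟨ω.map hv.aemeasurable, ?_, ?_⟩
  · change ∀ᵐ ν ∂((ω : Measure multiplicativeCRS).map Subtype.val), ν ∈ multiplicativeCRS
    refine (ae_map_iff hv.aemeasurable isClosed_multiplicativeCRS.measurableSet).2 ?_
    exact Eventually.of_forall fun ν => ν.2
  · let κ : ProbabilityTheory.Kernel multiplicativeCRS (ClosedAddSubgroup Torus) :=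
      ⟨fun ν => (ν.1 : Measure (ClosedAddSubgroup Torus)), measurable_subtype_coe.comp hv⟩
    have hκ : ProbabilityTheory.IsMarkovKernel κ :=
      ⟨fun ν => inferInstanceAs (IsProbabilityMeasure (ν.1 : Measure (ClosedAddSubgroup Torus)))⟩
    let η : ProbabilityTheory.Kernel Unit multiplicativeCRS :=
      ProbabilityTheory.Kernel.const Unit (ω : Measure multiplicativeCRS)
    have hjoin : (κ.comp η) () = (μ : Measure (ClosedAddSubgroup Torus)) := by
      refine measure_ext_of_perpFinset _ _ fun B => ?_
      have hB := (isClopen_perpFinset B).isOpen.measurableSet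
      obtain ⟨l, hl⟩ := CRS.exists_measure_perpFinset B
      rw [ProbabilityTheory.Kernel.comp_apply' _ _ _ hB, hl μ hμ]
      change ∫⁻ ν : multiplicativeCRS, (ν.1 : Measure (ClosedAddSubgroup Torus)) (perpFinset B)
        ∂(ω : Measure multiplicativeCRS) = _
      rw [← ofReal_measureReal (μ := (μ : Measure (ClosedAddSubgroup Torus)))]
      change _ = ENNReal.ofReal (coeff μ l)
      rw [← hω, barycenterCoeff, ofReal_integral_eq_lintegral_ofReal (integrable_coeff _ _)
        (Eventually.of_forall fun ν => coeff_nonneg _ _)]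
      refine lintegral_congr fun ν => ?_
      rw [hl ν.1 ν.2.1, coeff, ofReal_measureReal]
    intro f
    change _ = ∫ ν, (∫ x, f x ∂(ν : Measure (ClosedAddSubgroup Torus)))
      ∂((ω : Measure multiplicativeCRS).map Subtype.val)
    rw [integral_map hv.aemeasurable]
    · rw [← hjoin, ProbabilityTheory.Kernel.integral_comp]
      · rfl
      · exact f.integrable _
    · exact (ProbabilityMeasure.continuous_integral_boundedContinuousFunction
        f).aestronglyMeasurable

/-- Concatenating lists multiplies coefficients, so the functions `coeffFun` form a monoid that
separates points, and Stone–Weierstrass applies. -/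
theorem measure_multiplicativeCRS_ext (ω₁ ω₂ : Measure multiplicativeCRS) [IsFiniteMeasure ω₁]
    [IsFiniteMeasure ω₂]
    (h : ∀ l, ∫ ν : multiplicativeCRS, coeff ν.1 l ∂ω₁ = ∫ ν : multiplicativeCRS, coeff ν.1 l ∂ω₂) :
    ω₁ = ω₂ := by
  have := polishSpace_of_compact_metrizable multiplicativeCRS
  let S : Submonoid (BoundedContinuousFunction multiplicativeCRS ℝ) :=
    { carrier := Set.range coeffFun
      one_mem' := ⟨[], by ext ν; exact coeff_nil _⟩
      mul_mem' := by
        rintro _ _ ⟨l, rfl⟩ ⟨l', rfl⟩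
        exact ⟨l ++ l', by ext ν; exact ν.2.2.coeff_append l l'⟩ }
  refine measure_ext_of_submonoid_integral_eq S (fun f hf => ?_) ?_ ω₁ ω₂ ?_
  · have : star f = f := by
      ext
      simp
    rwa [this]
  · intro ν ν' hne
    by_contra! hcon
    refine hne (Subtype.ext (CRS.ext_coeff ν.2.1 ν'.2.1 (funext fun l => ?_)))
    exact hcon _ ⟨l, rfl⟩
  · rintro _ ⟨l, rfl⟩
    exact h l

/-- Testing the barycenter formula on indicators of clopen diagonal events shows that the
coefficients of `μ` fix all the integrals of `coeffFun`. -/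
theorem CRS.repr_unique {μ : ProbabilityMeasure (ClosedAddSubgroup Torus)}
    {ω₁ ω₂ : ProbabilityMeasure (ProbabilityMeasure (ClosedAddSubgroup Torus))}
    (h₁ : ∀ᵐ ν ∂(ω₁ : Measure (ProbabilityMeasure (ClosedAddSubgroup Torus))),
      ν ∈ multiplicativeCRS) (hb₁ : IsBarycenter ω₁ μ)
    (h₂ : ∀ᵐ ν ∂(ω₂ : Measure (ProbabilityMeasure (ClosedAddSubgroup Torus))),
      ν ∈ multiplicativeCRS) (hb₂ : IsBarycenter ω₂ μ) : ω₁ = ω₂ := by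
  have hM := isClosed_multiplicativeCRS.measurableSet
  have key : ∀ ω : ProbabilityMeasure (ProbabilityMeasure (ClosedAddSubgroup Torus)),
      (∀ᵐ ν ∂(ω : Measure (ProbabilityMeasure (ClosedAddSubgroup Torus))),
        ν ∈ multiplicativeCRS) → IsBarycenter ω μ →
      ((ω : Measure (ProbabilityMeasure (ClosedAddSubgroup Torus))).comap
          (Subtype.val : multiplicativeCRS → _)).map Subtype.val = ω ∧
      ∀ l, ∫ ν : multiplicativeCRS, coeff ν.1 l
        ∂((ω : Measure (ProbabilityMeasure (ClosedAddSubgroup Torus))).comap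
          (Subtype.val : multiplicativeCRS → _)) = coeff μ l := by
    intro ω hω hb
    have hr : (ω : Measure (ProbabilityMeasure (ClosedAddSubgroup Torus))).restrict
        multiplicativeCRS = ω := Measure.restrict_eq_self_of_ae_mem hω
    refine ⟨by rw [map_comap_subtype_coe hM, hr], fun l => ?_⟩
    rw [integral_subtype_comap hM (fun ν => coeff ν l), hr]
    have := hb (BoundedContinuousFunction.indicator _ (isClopen_diagSet l))
    have e : ∀ ν : ProbabilityMeasure (ClosedAddSubgroup Torus),
        ∫ x, BoundedContinuousFunction.indicator _ (isClopen_diagSet l) x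
          ∂(ν : Measure (ClosedAddSubgroup Torus)) = coeff ν l :=
      fun ν => integral_indicator_one (isClopen_diagSet l).isOpen.measurableSet
    simp only [e] at this
    exact this.symm
  obtain ⟨e₁, i₁⟩ := key ω₁ h₁ hb₁
  obtain ⟨e₂, i₂⟩ := key ω₂ h₂ hb₂
  refine ProbabilityMeasure.toMeasure_injective ?_
  rw [← e₁, ← e₂, measure_multiplicativeCRS_ext _ _ fun l => (i₁ l).trans (i₂ l).symm]

theorem isBauerSimplex_CRS : IsBauerSimplex (CRS Torus) where
  isCompact := isClosed_CRS.isCompact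
  convex := by
    rintro _ ⟨μ₁, h₁, rfl⟩ _ ⟨μ₂, h₂, rfl⟩ a b _ _ hab
    exact ⟨_, mixMeasure_mem_CRS a b hab h₁ h₂, rfl⟩
  existsUnique_repr := by
    intro μ hμ
    have he : extremeMeasures (CRS Torus) = multiplicativeCRS := CRSe_eq_multiplicativeCRS
    rw [he]
    obtain ⟨ω, h, hb⟩ := CRS.exists_repr hμ
    exact ⟨ω, ⟨h, hb⟩, fun ω' h' => CRS.repr_unique h'.1 h'.2 h hb⟩
  isClosed_extreme := isClosed_CRSe

/-- Convergence of characteristic random subgroups with independent diagonal events. -/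
theorem tendsto_of_tendsto_coeff {lam : ℕ → ProbabilityMeasure (ClosedAddSubgroup Torus)}
    {μ : ProbabilityMeasure (ClosedAddSubgroup Torus)} (hl : ∀ i, lam i ∈ multiplicativeCRS)
    (hμ : μ ∈ multiplicativeCRS)
    (h : ∀ d, Tendsto (fun i => coeff (lam i) [d]) atTop (𝓝 (coeff μ [d]))) :
    Tendsto lam atTop (𝓝 μ) := by
  let lam' : ℕ → multiplicativeCRS := fun i => ⟨lam i, hl i⟩
  suffices h' : Tendsto lam' atTop (𝓝 ⟨μ, hμ⟩) from
    (continuous_subtype_val.tendsto _).comp h'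
  let C : multiplicativeCRS → List ℕ → ℝ := fun ν => coeff ν.1
  -- On this compact space weak* convergence is convergence of coefficients, which the product
  -- formula reduces to lists of length one.
  have hC : IsClosedEmbedding C :=
    (continuous_coeff.comp continuous_subtype_val).isClosedEmbedding fun ν ν' hν =>
      Subtype.ext (CRS.ext_coeff ν.2.1 ν'.2.1 hν)
  rw [hC.isInducing.tendsto_nhds_iff, tendsto_pi_nhds]
  intro l
  have e : ∀ ν : multiplicativeCRS, C ν l = (l.map fun d => coeff ν.1 [d]).prod :=
    fun ν => ν.2.2.coeff_eq l
  simp only [Function.comp_apply, e]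
  exact tendsto_list_prod l fun d _ => h d

/-! ### The proportion of `d`-torsion elements in a finite abelian group -/

/-- The proportion of the elements of `F` that are killed by `d`. -/
def torsionRatio (F : Type*) [AddCommGroup F] (d : ℕ) : ℝ :=
  Nat.card {x : F // d • x = 0} / Nat.card F

theorem torsionRatio_congr {F F' : Type*} [AddCommGroup F] [AddCommGroup F'] (e : F ≃+ F')
    (d : ℕ) : torsionRatio F d = torsionRatio F' d := by
  have h : Nat.card {x : F // d • x = 0} = Nat.card {x : F' // d • x = 0} :=
    Nat.card_congr (e.toEquiv.subtypeEquiv fun x => by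
      rw [AddEquiv.toEquiv_eq_coe, EquivLike.coe_coe, ← map_nsmul, map_eq_zero_iff e e.injective])
  rw [torsionRatio, torsionRatio, h, Nat.card_congr e.toEquiv]

theorem torsionRatio_nonneg (F : Type*) [AddCommGroup F] (d : ℕ) : 0 ≤ torsionRatio F d := by
  unfold torsionRatio
  positivity

theorem torsionRatio_eq_one {F : Type*} [AddCommGroup F] [Finite F] {d : ℕ}
    (h : ∀ x : F, d • x = 0) : torsionRatio F d = 1 := by
  rw [torsionRatio, Nat.card_congr (Equiv.subtypeUnivEquiv h)]
  exact div_self (Nat.cast_ne_zero.2 Nat.card_pos.ne')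

theorem torsionRatio_lt_one {F : Type*} [AddCommGroup F] [Finite F] {d : ℕ} {x : F}
    (h : d • x ≠ 0) : torsionRatio F d < 1 := by
  rw [torsionRatio, div_lt_one (Nat.cast_pos.2 Nat.card_pos)]
  exact_mod_cast Finite.card_subtype_lt (p := fun x : F => d • x = 0) h

theorem torsionRatio_prod (F F' : Type*) [AddCommGroup F] [AddCommGroup F'] (d : ℕ) :
    torsionRatio (F × F') d = torsionRatio F d * torsionRatio F' d := by
  have h : Nat.card {x : F × F' // d • x = 0} =
      Nat.card {x : F // d • x = 0} * Nat.card {x : F' // d • x = 0} := by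
    rw [← Nat.card_prod]
    refine Nat.card_congr (Equiv.trans (Equiv.subtypeEquivRight fun x => ?_)
      (Equiv.subtypeProdEquivProd (p := fun x : F => d • x = 0) (q := fun x : F' => d • x = 0)))
    rw [Prod.ext_iff]
    rfl
  rw [torsionRatio, torsionRatio, torsionRatio, h, Nat.card_prod, Nat.cast_mul, Nat.cast_mul,
    mul_div_mul_comm]

theorem torsionRatio_pi {ι : Type*} [Fintype ι] (F : ι → Type*) [∀ i, AddCommGroup (F i)] (d : ℕ) :
    torsionRatio (∀ i, F i) d = ∏ i, torsionRatio (F i) d := by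
  have h : Nat.card {x : ∀ i, F i // d • x = 0} = ∏ i, Nat.card {x : F i // d • x = 0} := by
    rw [← Nat.card_pi]
    refine Nat.card_congr (Equiv.trans (Equiv.subtypeEquivRight fun x => ?_)
      (Equiv.subtypePiEquivPi (p := fun i (x : F i) => d • x = 0)))
    rw [funext_iff]
    rfl
  simp only [torsionRatio]
  rw [h, Nat.card_pi, Nat.cast_prod, Nat.cast_prod, Finset.prod_div_distrib]

theorem torsionRatio_mul_card_range (F : Type*) [AddCommGroup F] [Finite F] (d : ℕ) :
    torsionRatio F d * Nat.card (nsmulAddMonoidHom (α := F) d).range = 1 := by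
  have h := (nsmulAddMonoidHom (α := F) d).ker.card_mul_index
  rw [AddSubgroup.index_ker] at h
  have h1 : (Nat.card F : ℝ) ≠ 0 := Nat.cast_ne_zero.2 Nat.card_pos.ne'
  have h2 : Nat.card (nsmulAddMonoidHom (α := F) d).ker = Nat.card {x : F // d • x = 0} := rfl
  rw [torsionRatio, ← h2, div_mul_eq_mul_div, div_eq_one_iff_eq h1]
  exact_mod_cast h

theorem exists_addOrderOf_eq_maxOrder (F : Type*) [AddCommGroup F] [Finite F] :
    ∃ x : F, addOrderOf x = maxOrder F :=
  Nat.sSup_mem (Set.range_nonempty _) (Set.finite_range _).bddAbove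

theorem addOrderOf_le_maxOrder {F : Type*} [AddCommGroup F] [Finite F] (x : F) :
    addOrderOf x ≤ maxOrder F :=
  le_csSup (Set.finite_range _).bddAbove ⟨x, rfl⟩

/-- If `x` has maximal order, then `d • x` has order at least `maxOrder F / d`, so `dF` has at least
that many elements, and the ratio is the inverse of `|dF|`. -/
theorem torsionRatio_le_div_maxOrder (F : Type*) [AddCommGroup F] [Finite F] {d : ℕ} (hd : 0 < d) :
    torsionRatio F d ≤ d / maxOrder F := by
  obtain ⟨x, hx⟩ := exists_addOrderOf_eq_maxOrder F
  have hpos : 0 < maxOrder F := hx ▸ addOrderOf_pos x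
  let y : (nsmulAddMonoidHom (α := F) d).range := ⟨d • x, x, rfl⟩
  have h1 : addOrderOf x ∣ addOrderOf y * d := by
    rw [addOrderOf_dvd_iff_nsmul_eq_zero, mul_smul]
    exact congrArg Subtype.val (addOrderOf_nsmul_eq_zero y)
  have h2 : maxOrder F ≤ Nat.card (nsmulAddMonoidHom (α := F) d).range * d := by
    rw [← hx]
    exact (Nat.le_of_dvd (Nat.mul_pos (addOrderOf_pos y) hd) h1).trans
      (Nat.mul_le_mul_right d (Nat.le_of_dvd Nat.card_pos (addOrderOf_dvd_natCard y)))
  rw [le_div_iff₀ (by exact_mod_cast hpos)]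
  calc torsionRatio F d * maxOrder F
      ≤ torsionRatio F d * (Nat.card (nsmulAddMonoidHom (α := F) d).range * d) := by
        gcongr
        · exact torsionRatio_nonneg F d
        · exact_mod_cast h2
    _ = d := by rw [← mul_assoc, torsionRatio_mul_card_range, one_mul]

theorem ZMod.forall_nsmul_eq_zero_iff (k d : ℕ) : (∀ x : ZMod k, d • x = 0) ↔ k ∣ d := by
  constructor
  · intro h
    have := h 1
    rwa [nsmul_eq_mul, mul_one, ZMod.natCast_eq_zero_iff] at this
  · intro h x
    rw [nsmul_eq_mul, (ZMod.natCast_eq_zero_iff d k).2 h, zero_mul]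

/-! ### The dual of a finite abelian group -/

theorem AddCircle.exists_toCircle_eq (z : Circle) : ∃ x : AddCircle (1 : ℝ), x.toCircle = z := by
  obtain ⟨x, hx⟩ := (AddCircle.homeomorphCircle (one_ne_zero (α := ℝ))).surjective z
  exact ⟨x, by rw [← hx, AddCircle.homeomorphCircle_apply]⟩

/-- The circle contains enough roots of unity; the rest is translation between additive and
multiplicative notation. It is needed to count the characters of `F` killed by `d`. -/
theorem nonempty_dual_addEquiv (F : Type*) [AddCommGroup F] [Finite F] :
    Nonempty ((F →+ AddCircle (1 : ℝ)) ≃+ F) := by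
  have : NeZero (Monoid.exponent (Multiplicative F)) := ⟨Monoid.exponent_ne_zero_of_finite⟩
  obtain ⟨e⟩ := CommGroup.monoidHom_mulEquiv_of_hasEnoughRootsOfUnity (Multiplicative F) Circle
  let c : (F →+ AddCircle (1 : ℝ)) → (Multiplicative F →* Circleˣ) := fun χ =>
    { toFun := fun x => toUnits (χ x.toAdd).toCircle
      map_one' := by simp
      map_mul' := fun x y => by simp [AddCircle.toCircle_add] }
  have hcadd : ∀ χ χ', c (χ + χ') = c χ * c χ' := by
    intro χ χ'
    ext x
    simp [c, AddCircle.toCircle_add]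
  let c' : (F →+ AddCircle (1 : ℝ)) →+ Additive (Multiplicative F →* Circleˣ) :=
    AddMonoidHom.mk' (fun χ => Additive.ofMul (c χ)) fun χ χ' => congrArg Additive.ofMul (hcadd χ χ')
  have hinj : Function.Injective c' := by
    intro χ χ' h
    ext x
    have h1 : c χ = c χ' := Additive.ofMul.injective h
    have h2 := DFunLike.congr_fun h1 (Multiplicative.ofAdd x)
    exact AddCircle.injective_toCircle one_ne_zero (toUnits.injective h2)
  have hsurj : Function.Surjective c' := by
    intro ψ
    choose s hs using AddCircle.exists_toCircle_eq
    refine ⟨AddMonoidHom.mk' (fun x => s ((ψ.toMul (Multiplicative.ofAdd x) : Circleˣ) : Circle))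
      fun x y => ?_, ?_⟩
    · apply AddCircle.injective_toCircle one_ne_zero
      rw [AddCircle.toCircle_add, hs, hs, hs, ofAdd_add, map_mul, Units.val_mul]
    · apply Additive.toMul.injective
      ext x
      simp [c', c, hs]
  let E : (F →+ AddCircle (1 : ℝ)) ≃+ Additive (Multiplicative F →* Circleˣ) :=
    AddEquiv.ofBijective c' ⟨hinj, hsurj⟩
  exact ⟨E.trans (MulEquiv.toAdditiveLeft e)⟩

/-! ### Uniform distribution of homomorphic images -/

/-- The fibres of `ψ` are translates of one another, so an invariant measure pushes forward to the
uniform distribution. -/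
theorem measureReal_preimage_of_surjective {G Q : Type*} [AddCommGroup G] [MeasurableSpace G]
    [MeasurableAdd G] (m : Measure G) [IsProbabilityMeasure m] [m.IsAddLeftInvariant]
    [AddCommGroup Q] [Finite Q] (ψ : G →+ Q) (hψ : Function.Surjective ψ)
    (hm : ∀ q, MeasurableSet (ψ ⁻¹' {q})) (s : Set Q) :
    m.real (ψ ⁻¹' s) = Nat.card s / Nat.card Q := by
  classical
  have := Fintype.ofFinite Q
  have hfib : ∀ q, m.real (ψ ⁻¹' {q}) = m.real (ψ ⁻¹' {0}) := by
    intro q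
    obtain ⟨g, rfl⟩ := hψ q
    rw [measureReal_def, measureReal_def, ← measure_preimage_add m g (ψ ⁻¹' {ψ g})]
    congr 2
    ext x
    simp
  have hs : ∀ s : Finset Q, m.real (ψ ⁻¹' (s : Set Q)) = s.card * m.real (ψ ⁻¹' {0}) := by
    intro s
    have h1 : ψ ⁻¹' (s : Set Q) = ⋃ q ∈ s, ψ ⁻¹' {q} := by
      ext x
      simp
    rw [h1, measureReal_biUnion_finset (fun q _ q' _ hne => ?_) fun q _ => hm q,
      Finset.sum_congr rfl fun q _ => hfib q, Finset.sum_const, nsmul_eq_mul]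
    exact Disjoint.preimage _ (Set.disjoint_singleton.2 hne)
  have h1 := hs Finset.univ
  rw [Finset.coe_univ, Set.preimage_univ, probReal_univ, Finset.card_univ,
    ← Nat.card_eq_fintype_card] at h1
  have h2 := hs s.toFinset
  rw [Set.coe_toFinset, Set.toFinset_card, ← Nat.card_eq_fintype_card] at h2
  have h3 : (Nat.card Q : ℝ) ≠ 0 := Nat.cast_ne_zero.2 Nat.card_pos.ne'
  rw [h2, eq_div_iff h3, mul_assoc, mul_comm (m.real _), ← h1, mul_one]

/-! ### The laws `pairLaw F n` -/

theorem mem_Ann_multiples {n : ℕ} {y : Torus} : y ∈ Ann (multiples n) ↔ n • y = 0 := by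
  constructor
  · intro h
    ext i
    have := h (n • Finsupp.single i 1) ⟨_, rfl⟩
    rw [← pairingHom_apply, map_nsmul, AddMonoidHom.nsmul_apply, pairingHom_apply,
      pairing_single, one_smul] at this
    exact this
  · rintro h _ ⟨x, rfl⟩
    change pairing (n • x) y = 0
    rw [← pairingHom_apply, map_nsmul, AddMonoidHom.nsmul_apply, ← map_nsmul, h, map_zero]

theorem AddCircle.forall_torsion_nsmul_eq_zero_iff (n d : ℕ) :
    (∀ z : AddCircle (1 : ℝ), n • z = 0 → d • z = 0) ↔ n ∣ d := by
  constructor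
  · intro h
    rcases Nat.eq_zero_or_pos n with rfl | hn
    · rw [zero_dvd_iff]
      by_contra hd
      -- For `n = 0` every point of the circle is allowed, and a point of order `2d` is not killed
      -- by `d`.
      have hd2 : 0 < 2 * d := by omega
      have h1 := h (((1 : ℝ) / (2 * d : ℕ) : ℝ) : AddCircle (1 : ℝ)) (zero_smul _ _)
      rw [← addOrderOf_dvd_iff_nsmul_eq_zero, AddCircle.addOrderOf_period_div hd2] at h1
      have := Nat.le_of_dvd (by omega) h1
      omega
    · have h1 := h (((1 : ℝ) / n : ℝ) : AddCircle (1 : ℝ)) (by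
        rw [← addOrderOf_dvd_iff_nsmul_eq_zero, AddCircle.addOrderOf_period_div hn])
      rwa [← addOrderOf_dvd_iff_nsmul_eq_zero, AddCircle.addOrderOf_period_div hn] at h1
  · rintro ⟨k, rfl⟩ z hz
    rw [mul_comm, mul_smul, hz, smul_zero]

/-- The first `k` coordinates of a homomorphism to the torus. -/
def homCoords (F : Type*) [AddCommGroup F] [TopologicalSpace F] (k : ℕ) :
    (F →ₜ+ Torus) →+ (Fin k → F →+ AddCircle (1 : ℝ)) :=
  AddMonoidHom.mk' (fun h i => (Pi.evalAddMonoidHom _ (i : ℕ)).comp (h : F →+ Torus))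
    fun _ _ => rfl

theorem homCoords_apply (F : Type*) [AddCommGroup F] [TopologicalSpace F] (k : ℕ)
    (h : F →ₜ+ Torus) (i : Fin k) (x : F) :
    homCoords F k h i x = h x i := rfl

theorem homCoords_surjective (F : Type*) [AddCommGroup F] [TopologicalSpace F]
    [DiscreteTopology F] (k : ℕ) : Function.Surjective (homCoords F k) := by
  intro q
  let h : F →+ Torus := AddMonoidHom.pi fun j => if hj : j < k then q ⟨j, hj⟩ else 0
  refine ⟨⟨h, continuous_of_discreteTopology⟩, ?_⟩
  ext i x
  change (if hj : (i : ℕ) < k then q ⟨i, hj⟩ else 0) x = q i x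
  rw [dif_pos i.2]

theorem measurableSet_homCoords_preimage (F : Type*) [AddCommGroup F] [TopologicalSpace F]
    [DiscreteTopology F] (k : ℕ) (q : Fin k → F →+ AddCircle (1 : ℝ)) :
    MeasurableSet (homCoords F k ⁻¹' {q}) := by
  have : homCoords F k ⁻¹' {q} = ⋂ i : Fin k, ⋂ x : F, {h : F →ₜ+ Torus | h x i = q i x} := by
    ext h
    simp only [Set.mem_preimage, Set.mem_singleton_iff, Set.mem_iInter, Set.mem_ofPred_eq,
      funext_iff, DFunLike.ext_iff, homCoords_apply]
  rw [this]
  refine (isClosed_iInter fun i => isClosed_iInter fun x =>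
    isClosed_eq ?_ continuous_const).measurableSet
  exact (continuous_apply (i : ℕ)).comp ((continuous_apply x).comp
    ContinuousAddMonoidHom.isClosedEmbedding_coe.continuous)

instance (F : Type*) [AddCommGroup F] [TopologicalSpace F] [DiscreteTopology F] :
    (haarHom F).IsAddHaarMeasure := by
  unfold haarHom
  infer_instance

/-- Composition with `φ` is a continuous surjective endomorphism of the compact group `Hom(F, 𝕋^ℕ)`,
whose Haar probability measure is unique. -/
theorem map_comp_haarHom (F : Type*) [AddCommGroup F] [TopologicalSpace F] [DiscreteTopology F]
    (φ : Torus ≃ₜ+ Torus) :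
    (haarHom F).map (fun h => (⟨φ, φ.continuous_toFun⟩ : Torus →ₜ+ Torus).comp h) = haarHom F := by
  let p : (F →ₜ+ Torus) →+ (F →ₜ+ Torus) :=
    AddMonoidHom.mk' (fun h => (⟨φ, φ.continuous_toFun⟩ : Torus →ₜ+ Torus).comp h) fun h h' => by
      ext x i
      exact congrFun (map_add φ (h x) (h' x)) i
  have hp : Continuous p := ContinuousAddMonoidHom.continuous_comp_right _
  have hsurj : Function.Surjective p := fun h =>
    ⟨(⟨φ.symm, φ.symm.continuous_toFun⟩ : Torus →ₜ+ Torus).comp h, by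
      ext x i
      exact congrFun (φ.apply_symm_apply (h x)) i⟩
  have : ((haarHom F).map p).IsAddHaarMeasure :=
    Measure.isAddHaarMeasure_map _ p hp hsurj (by simp [cocompact_eq_bot])
  have : IsProbabilityMeasure ((haarHom F).map p) :=
    Measure.isProbabilityMeasure_map hp.measurable.aemeasurable
  exact Measure.isAddHaarMeasure_eq_of_isProbabilityMeasure ((haarHom F).map p) (haarHom F)

/-! ### Coefficients and invariance of the laws of the pairs -/

section PairLaw

variable (F : Type*) [AddCommGroup F] [TopologicalSpace F] [DiscreteTopology F] [Finite F]

theorem mem_annAddImage {F : Type*} [AddCommGroup F] [TopologicalSpace F] [DiscreteTopology F]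
    [Finite F] {n : ℕ} {h : F →ₜ+ Torus} {z : Torus} :
    z ∈ annAddImage n h ↔ ∃ y, n • y = 0 ∧ ∃ x, y + h x = z := by
  change z ∈ Ann (multiples n) ⊔ (h : F →+ Torus).range ↔ _
  rw [AddSubgroup.mem_sup]
  constructor
  · rintro ⟨y, hy, _, ⟨x, rfl⟩, rfl⟩
    exact ⟨y, mem_Ann_multiples.1 hy, x, rfl⟩
  · rintro ⟨y, hy, x, rfl⟩
    exact ⟨y, mem_Ann_multiples.2 hy, _, ⟨x, rfl⟩, rfl⟩

theorem annAddImage_mem_perp_single {F : Type*} [AddCommGroup F] [TopologicalSpace F]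
    [DiscreteTopology F] [Finite F] {n : ℕ} {h : F →ₜ+ Torus} {i d : ℕ} :
    annAddImage n h ∈ perp (Finsupp.single i (d : ℤ)) ↔ n ∣ d ∧ ∀ x, d • h x i = 0 := by
  have key : annAddImage n h ∈ perp (Finsupp.single i (d : ℤ)) ↔
      ∀ y : Torus, n • y = 0 → ∀ x, d • y i + d • h x i = 0 := by
    constructor
    · intro H y hy x
      have := H _ (mem_annAddImage.2 ⟨y, hy, x, rfl⟩)
      rwa [pairing_single, natCast_zsmul, Pi.add_apply, smul_add] at this
    · intro H z hz
      obtain ⟨y, hy, x, rfl⟩ := mem_annAddImage.1 hz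
      rw [pairing_single, natCast_zsmul, Pi.add_apply, smul_add, H y hy x]
  rw [key]
  constructor
  · intro H
    refine ⟨?_, fun x => ?_⟩
    · rw [← AddCircle.forall_torsion_nsmul_eq_zero_iff]
      intro z hz
      -- The constant vector realises every `n`-torsion point `z` of the circle as an `i`th
      -- coordinate.
      have := H (fun _ => z) (funext fun _ => hz) 0
      simpa using this
    · have := H 0 (smul_zero _) x
      simpa using this
  · rintro ⟨hn, H⟩ y hy x
    rw [H, add_zero]
    exact (AddCircle.forall_torsion_nsmul_eq_zero_iff n d).2 hn _ (congrFun hy i)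

theorem mem_diagSet_iff {l : List ℕ} {H : ClosedAddSubgroup Torus} :
    H ∈ diagSet l ↔ ∀ i : Fin l.length, H ∈ perp (Finsupp.single (i : ℕ) ((l[(i : ℕ)] : ℕ) : ℤ)) := by
  constructor
  · intro h i
    have := h i
    rwa [List.getD_eq_getElem _ _ i.2] at this
  · intro h i
    by_cases hi : i < l.length
    · rw [List.getD_eq_getElem _ _ hi]
      exact h ⟨i, hi⟩
    · rw [List.getD_eq_default _ _ (not_lt.1 hi), Nat.cast_zero, Finsupp.single_zero, perp_zero]
      trivial

/-- If `n` divides every entry, the event concerns only the first coordinates of `h`, which are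
independent uniform characters of `F`; each is killed by `d` with the `d`-torsion proportion of the
dual group, which is that of `F`. Otherwise `Ann(n𝒜)` already violates the event. -/
theorem coeff_pairLaw (n : ℕ) (l : List ℕ) :
    coeff (pairLaw F n) l =
      (l.map fun d => if n ∣ d then torsionRatio F d else 0).prod := by
  have h1 : coeff (pairLaw F n) l = (haarHom F).real (annAddImage n ⁻¹' diagSet l) := by
    change ((haarHom F).map (annAddImage n)).real (diagSet l) = _
    rw [measureReal_def, Measure.map_apply (continuous_annAddImage F n).measurable
      (isClopen_diagSet l).isOpen.measurableSet]
    rfl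
  rw [h1]
  by_cases hl : ∀ d ∈ l, n ∣ d
  · obtain ⟨e⟩ := nonempty_dual_addEquiv F
    have : Finite (F →+ AddCircle (1 : ℝ)) := Finite.of_equiv F e.symm.toEquiv
    have h2 : (annAddImage n : (F →ₜ+ Torus) → _) ⁻¹' diagSet l = homCoords F l.length ⁻¹'
        {q | ∀ i : Fin l.length, l[(i : ℕ)] • q i = 0} := by
      ext h
      simp only [Set.mem_preimage, mem_diagSet_iff, annAddImage_mem_perp_single,
        Set.mem_ofPred_eq]
      refine forall_congr' fun i => ?_
      rw [and_iff_right (hl _ (List.getElem_mem _)), DFunLike.ext_iff]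
      rfl
    have h3 : Nat.card {q : Fin l.length → F →+ AddCircle (1 : ℝ) |
        ∀ i : Fin l.length, l[(i : ℕ)] • q i = 0} =
        ∏ i : Fin l.length, Nat.card {χ : F →+ AddCircle (1 : ℝ) // l[(i : ℕ)] • χ = 0} := by
      rw [← Nat.card_pi]
      exact Nat.card_congr (Equiv.subtypePiEquivPi
        (p := fun (i : Fin l.length) (χ : F →+ AddCircle (1 : ℝ)) => l[(i : ℕ)] • χ = 0))
    rw [h2, measureReal_preimage_of_surjective _ _ (homCoords_surjective F l.length)
      (measurableSet_homCoords_preimage F l.length), h3, Nat.card_pi, Nat.cast_prod, Nat.cast_prod,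
      ← Finset.prod_div_distrib]
    have h4 : ∀ i : Fin l.length,
        (Nat.card {χ : F →+ AddCircle (1 : ℝ) // l[(i : ℕ)] • χ = 0} : ℝ) /
          Nat.card (F →+ AddCircle (1 : ℝ)) = torsionRatio F l[(i : ℕ)] :=
      fun i => torsionRatio_congr e _
    rw [Finset.prod_congr rfl fun i _ => h4 i]
    have h5 : (l.map fun d => if n ∣ d then torsionRatio F d else 0) = l.map (torsionRatio F) :=
      List.map_congr_left fun d hd => if_pos (hl d hd)
    rw [h5, ← List.prod_ofFn]
    congr 1
    exact List.ext_getElem (by simp) fun i _ _ => by simp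
  · push Not at hl
    obtain ⟨d, hd, hnd⟩ := hl
    have h2 : (annAddImage n : (F →ₜ+ Torus) → _) ⁻¹' diagSet l = ∅ := by
      ext h
      simp only [Set.mem_preimage, mem_diagSet_iff, annAddImage_mem_perp_single,
        Set.mem_empty_iff_false, iff_false, not_forall]
      obtain ⟨i, hi, rfl⟩ := List.getElem_of_mem hd
      exact ⟨⟨i, hi⟩, fun H => hnd H.1⟩
    rw [h2, measureReal_empty]
    exact (List.prod_eq_zero (List.mem_map.2 ⟨d, hd, if_neg hnd⟩)).symm

theorem coeff_pairLaw_singleton (n d : ℕ) :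
    coeff (pairLaw F n) [d] = if n ∣ d then torsionRatio F d else 0 := by
  rw [coeff_pairLaw]
  simp

/-- An automorphism `φ` preserves `n`-torsion, so it takes the subgroup built from `h` to the one
built from `φ ∘ h`, which has the same law. -/
theorem pairLaw_mem_CRS (n : ℕ) : pairLaw F n ∈ CRS Torus := by
  intro φ
  change ((haarHom F).map (annAddImage n)).map _ = (haarHom F).map (annAddImage n)
  have hc : Measurable fun h : F →ₜ+ Torus => (⟨φ, φ.continuous_toFun⟩ : Torus →ₜ+ Torus).comp h :=
    (ContinuousAddMonoidHom.continuous_comp_right _).measurable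
  conv_rhs => rw [← map_comp_haarHom F φ]
  rw [Measure.map_map (ClosedAddSubgroup.continuous_mapAut φ).measurable
    (continuous_annAddImage F n).measurable, Measure.map_map
    (continuous_annAddImage F n).measurable hc]
  congr 1
  ext1 h
  refine SetLike.ext fun z => ?_
  rw [Function.comp_apply, Function.comp_apply, mem_annAddImage]
  constructor
  · rintro ⟨w, hw, rfl⟩
    obtain ⟨y, hy, x, rfl⟩ := mem_annAddImage.1 hw
    exact ⟨φ y, by rw [← map_nsmul, hy, map_zero], x, (map_add φ y (h x)).symm⟩
  · rintro ⟨y, hy, x, rfl⟩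
    refine ⟨φ.symm y + h x, mem_annAddImage.2 ⟨φ.symm y, by rw [← map_nsmul, hy, map_zero], x, rfl⟩,
      ?_⟩
    change φ (φ.symm y + h x) = y + φ (h x)
    rw [map_add, φ.apply_symm_apply]

theorem pairLaw_mem_multiplicativeCRS (n : ℕ) : pairLaw F n ∈ multiplicativeCRS := by
  refine ⟨pairLaw_mem_CRS F n, fun d l => ?_⟩
  rw [coeff_pairLaw, coeff_pairLaw_singleton, coeff_pairLaw, List.map_cons, List.prod_cons]

theorem pairLaw_mem_CRSe (n : ℕ) : pairLaw F n ∈ CRSe Torus :=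
  CRSe_eq_multiplicativeCRS ▸ pairLaw_mem_multiplicativeCRS F n

end PairLaw

theorem pairLaw_eq_of_torsionRatio {F F' : Type*} [AddCommGroup F] [TopologicalSpace F]
    [DiscreteTopology F] [Finite F] [AddCommGroup F'] [TopologicalSpace F'] [DiscreteTopology F']
    [Finite F'] {n : ℕ} (h : ∀ d, n ∣ d → torsionRatio F d = torsionRatio F' d) :
    pairLaw F n = pairLaw F' n := by
  refine CRS.ext_coeff (pairLaw_mem_CRS F n) (pairLaw_mem_CRS F' n) (funext fun l => ?_)
  rw [coeff_pairLaw, coeff_pairLaw]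
  congr 1
  refine List.map_congr_left fun d _ => ?_
  by_cases hd : n ∣ d
  · rw [if_pos hd, if_pos hd, h d hd]
  · rw [if_neg hd, if_neg hd]

/-- Writing the point mass as a pair law makes it multiplicative, so the coefficient criterion
covers it as a limit. -/
theorem pairLaw_unit_zero : pairLaw Unit 0 = diracFull Torus := by
  refine Subtype.ext ?_
  change (haarHom Unit).map (annAddImage 0) = Measure.dirac _
  have : (annAddImage 0 : (Unit →ₜ+ Torus) → _) = fun _ => ClosedAddSubgroup.full Torus := by
    ext1 h
    refine SetLike.ext fun z => ⟨fun _ => AddSubgroup.mem_top z, fun _ => ?_⟩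
    exact mem_annAddImage.2 ⟨z, zero_smul _ _, 0, by rw [map_zero, add_zero]⟩
  rw [this, Measure.map_const, measure_univ, one_smul]

/-! ### Limits of the first three types of sequences -/

section Limits

variable {n : ℕ → ℕ} {F : ℕ → Type*}
  [∀ i, AddCommGroup (F i)] [∀ i, Finite (F i)] [∀ i, TopologicalSpace (F i)]
  [∀ i, DiscreteTopology (F i)]

/-- The limit has coefficient `1` at `d = 0` and `0` at `d > 0`; at `d = 0` every pair law has
coefficient `1`. -/
theorem tendsto_pairLaw_diracFull
    (h : ∀ d, 0 < d → Tendsto (fun i => if n i ∣ d then torsionRatio (F i) d else 0) atTop (𝓝 0)) :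
    Tendsto (fun i => pairLaw (F i) (n i)) atTop (𝓝 (diracFull Torus)) := by
  rw [← pairLaw_unit_zero]
  refine tendsto_of_tendsto_coeff (fun i => pairLaw_mem_multiplicativeCRS _ _)
    (pairLaw_mem_multiplicativeCRS _ _) fun d => ?_
  simp only [coeff_pairLaw_singleton]
  rcases Nat.eq_zero_or_pos d with rfl | hd
  · have h1 : ∀ i, torsionRatio (F i) 0 = 1 := fun i => torsionRatio_eq_one fun x => zero_smul _ _
    simp only [dvd_zero, if_true, h1]
    rw [torsionRatio_eq_one (F := Unit) fun x => zero_smul _ _]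
    exact tendsto_const_nhds
  · rw [if_neg (by rw [zero_dvd_iff]; omega)]
    exact h d hd

theorem tendsto_pairLaw_of_isTypeOne (h : IsTypeOne n) :
    Tendsto (fun i => pairLaw (F i) (n i)) atTop (𝓝 (diracFull Torus)) := by
  refine tendsto_pairLaw_diracFull fun d hd => ?_
  refine tendsto_const_nhds.congr' ?_
  filter_upwards [h.eventually_gt_atTop d] with i hi
  rw [if_neg fun hdvd => absurd (Nat.le_of_dvd hd hdvd) (not_le.2 hi)]

theorem tendsto_pairLaw_of_maxOrder (h : Tendsto (fun i => maxOrder (F i)) atTop atTop) :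
    Tendsto (fun i => pairLaw (F i) (n i)) atTop (𝓝 (diracFull Torus)) := by
  refine tendsto_pairLaw_diracFull fun d hd => ?_
  have h1 : Tendsto (fun i => (d : ℝ) / maxOrder (F i)) atTop (𝓝 0) :=
    tendsto_const_nhds.div_atTop (tendsto_natCast_atTop_atTop.comp h)
  refine squeeze_zero (fun i => ?_) (fun i => ?_) h1
  · split_ifs
    · exact torsionRatio_nonneg _ _
    · exact le_rfl
  · split_ifs
    · exact torsionRatio_le_div_maxOrder _ hd
    · positivity

theorem torsionRatio_of_addEquiv {G : Type*} [AddCommGroup G] {E : Type*} [AddCommGroup E] {s : ℕ}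
    {q t : Fin s → ℕ} {m : Fin s → ℕ}
    (e : G ≃+ E × ((j : Fin s) → Fin (m j) → ZMod (q j ^ t j))) (d : ℕ) :
    torsionRatio G d = torsionRatio E d * ∏ j, torsionRatio (ZMod (q j ^ t j)) d ^ m j := by
  rw [torsionRatio_congr e, torsionRatio_prod, torsionRatio_pi]
  congr 1
  refine Finset.prod_congr rfl fun j _ => ?_
  rw [torsionRatio_pi, Finset.prod_const, Finset.card_univ, Fintype.card_fin]

theorem tendsto_torsionRatio_zmod_pow {k : ℕ} (hk : k ≠ 0) (d : ℕ) {m : ℕ → ℕ}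
    (hm : Tendsto m atTop atTop) :
    Tendsto (fun i => torsionRatio (ZMod k) d ^ m i) atTop (𝓝 (if k ∣ d then 1 else 0)) := by
  have : NeZero k := ⟨hk⟩
  split_ifs with h
  · rw [torsionRatio_eq_one ((ZMod.forall_nsmul_eq_zero_iff k d).2 h)]
    simp
  · rw [← ZMod.forall_nsmul_eq_zero_iff] at h
    push Not at h
    obtain ⟨x, hx⟩ := h
    exact (tendsto_pow_atTop_nhds_zero_of_lt_one (torsionRatio_nonneg _ _)
      (torsionRatio_lt_one hx)).comp hm

theorem limitModulus_dvd_iff {N s : ℕ} {q t : Fin s → ℕ} {d : ℕ} :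
    limitModulus N q t ∣ d ↔ N ∣ d ∧ ∀ j, q j ^ t j ∣ d := by
  rw [limitModulus, Nat.lcm_dvd_iff, Finset.lcm_dvd_iff]
  simp

/-- Each growing factor contributes in the limit the indicator of `q j ^ t j ∣ d`. Together with `N
∣ d` these say that the lcm divides `d`, leaving the torsion ratio of `E`. -/
theorem tendsto_pairLaw_of_isTypeThree {N : ℕ} {E : Type*} [AddCommGroup E] [Finite E]
    [TopologicalSpace E] [DiscreteTopology E] {s : ℕ} {q t : Fin s → ℕ} {m : Fin s → ℕ → ℕ}
    (h : IsTypeThree n F N E s q t m) :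
    Tendsto (fun i => pairLaw (F i) (n i)) atTop (𝓝 (pairLaw E (limitModulus N q t))) := by
  obtain ⟨hn, hq, hF, hm⟩ := h
  refine tendsto_of_tendsto_coeff (fun i => pairLaw_mem_multiplicativeCRS _ _)
    (pairLaw_mem_multiplicativeCRS _ _) fun d => ?_
  simp only [coeff_pairLaw_singleton]
  have h1 : Tendsto (fun i => if N ∣ d then torsionRatio E d *
      ∏ j, torsionRatio (ZMod (q j ^ t j)) d ^ m j i else 0) atTop
      (𝓝 (if N ∣ d then torsionRatio E d * ∏ j, (if q j ^ t j ∣ d then 1 else 0) else 0)) := by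
    by_cases hN : N ∣ d
    · simp only [if_pos hN]
      exact (tendsto_finsetProd _ fun j _ => tendsto_torsionRatio_zmod_pow
        (pow_ne_zero _ (hq j).ne_zero) d (hm j)).const_mul _
    · simp only [if_neg hN]
      exact tendsto_const_nhds
  have h2 : (if N ∣ d then torsionRatio E d * ∏ j, (if q j ^ t j ∣ d then (1 : ℝ) else 0) else 0) =
      if limitModulus N q t ∣ d then torsionRatio E d else 0 := by
    rw [Finset.prod_ite_zero]
    simp only [limitModulus_dvd_iff, Finset.mem_univ, true_imp_iff, Finset.prod_const_one]
    by_cases h1 : N ∣ d <;> by_cases h2 : ∀ j, q j ^ t j ∣ d <;> simp [h1, h2]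
  rw [← h2]
  refine h1.congr' ?_
  filter_upwards [hn, hF] with i hi hFi
  obtain ⟨e⟩ := hFi
  rw [hi, torsionRatio_of_addEquiv e]

end Limits

/-! ### Discarding a direct summand killed by the modulus -/

/-- Complementary subgroups decompose an abelian group as a product. -/
theorem nonempty_addEquiv_prod_of_isCompl {E : Type*} [AddCommGroup E] {A B : AddSubgroup E}
    (h : IsCompl A B) : Nonempty (A × B ≃+ E) := by
  refine ⟨AddEquiv.ofBijective (A.subtype.coprod B.subtype) ⟨?_, ?_⟩⟩
  · rw [injective_iff_map_eq_zero]
    rintro ⟨a, b⟩ hab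
    have hab' : (a : E) + b = 0 := hab
    have ha : (a : E) ∈ B := by
      rw [eq_neg_of_add_eq_zero_left hab']
      exact B.neg_mem b.2
    have ha0 : (a : E) = 0 := AddSubgroup.disjoint_def.1 h.disjoint a.2 ha
    rw [ha0, zero_add] at hab'
    exact Prod.ext (Subtype.ext ha0) (Subtype.ext hab')
  · intro x
    have hx : x ∈ A ⊔ B := h.sup_eq_top ▸ AddSubgroup.mem_top x
    obtain ⟨a, ha, b, hb, rfl⟩ := AddSubgroup.mem_sup.1 hx
    exact ⟨(⟨a, ha⟩, ⟨b, hb⟩), rfl⟩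

/-- Take `B` maximal among the direct summands killed by `M`. A nontrivial summand of its complement
killed by `M` could be added to `B`. -/
theorem exists_isCompl_isOver (E : Type*) [AddCommGroup E] [Finite E] (M : ℕ) :
    ∃ A B : AddSubgroup E, IsCompl A B ∧ (∀ b ∈ B, M • b = 0) ∧ IsOver A M := by
  have hne : {B : AddSubgroup E | (∃ A, IsCompl A B) ∧ ∀ b ∈ B, M • b = 0}.Nonempty :=
    ⟨⊥, ⟨⊤, isCompl_top_bot⟩, fun b hb => by rw [AddSubgroup.mem_bot.1 hb, smul_zero]⟩
  obtain ⟨B, ⟨⟨A, hAB⟩, hB⟩, hmax⟩ := (Set.toFinite _).exists_maximal hne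
  refine ⟨A, B, hAB, hB, fun A₁ B₁ hcompl hA₁ => ?_⟩
  by_contra! hcon
  obtain ⟨a, ha, ha0⟩ := (AddSubgroup.bot_or_exists_ne_zero A₁).resolve_left hA₁
  have hle : B ⊔ A₁.map A.subtype ≤ B := by
    refine hmax ⟨⟨B₁.map A.subtype, ?_⟩, ?_⟩ le_sup_left
    · constructor
      · rw [AddSubgroup.disjoint_def]
        rintro _ ⟨b₁, hb₁, rfl⟩ hx
        obtain ⟨b, hb, _, ⟨a₁, ha₁, rfl⟩, he⟩ := AddSubgroup.mem_sup.1 hx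
        have hbA : b ∈ A := by
          rw [eq_sub_of_add_eq he]
          exact A.sub_mem b₁.2 a₁.2
        have hb0 : b = 0 := AddSubgroup.disjoint_def.1 hAB.disjoint hbA hb
        rw [hb0, zero_add] at he
        have he' : a₁ = b₁ := Subtype.ext he
        have h0 := AddSubgroup.disjoint_def.1 hcompl.disjoint ha₁ (he' ▸ hb₁)
        rw [← he', h0, map_zero]
      · rw [codisjoint_iff, eq_top_iff]
        intro x _
        have hx : x ∈ A ⊔ B := hAB.sup_eq_top ▸ AddSubgroup.mem_top x
        obtain ⟨y, hy, b, hb, rfl⟩ := AddSubgroup.mem_sup.1 hx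
        have hy' : (⟨y, hy⟩ : A) ∈ A₁ ⊔ B₁ := hcompl.sup_eq_top ▸ AddSubgroup.mem_top _
        obtain ⟨a₁, ha₁, b₁, hb₁, he⟩ := AddSubgroup.mem_sup.1 hy'
        have he' : (a₁ : E) + b₁ = y := congrArg Subtype.val he
        rw [← he']
        refine add_mem (add_mem ?_ ?_) ?_
        · exact AddSubgroup.mem_sup_right (AddSubgroup.mem_sup_right ⟨a₁, ha₁, rfl⟩)
        · exact AddSubgroup.mem_sup_left ⟨b₁, hb₁, rfl⟩
        · exact AddSubgroup.mem_sup_right (AddSubgroup.mem_sup_left hb)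
    · intro x hx
      obtain ⟨b, hb, _, ⟨a₁, ha₁, rfl⟩, rfl⟩ := AddSubgroup.mem_sup.1 hx
      rw [smul_add, hB b hb, zero_add, ← map_nsmul, hcon a₁ ha₁, map_zero]
  have haB : (a : E) ∈ B := hle (AddSubgroup.mem_sup_right ⟨a, ha, rfl⟩)
  exact ha0 (Subtype.ext (AddSubgroup.disjoint_def.1 hAB.disjoint a.2 haB))

/-- Only multiples `d` of `M` have nonzero coefficients, and for those `B` has torsion ratio `1`. -/
theorem pairLaw_eq_of_isCompl {E : Type*} [AddCommGroup E] [Finite E] [TopologicalSpace E]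
    [DiscreteTopology E] {M : ℕ} {A B : AddSubgroup E} (h : IsCompl A B)
    (hB : ∀ b ∈ B, M • b = 0) : pairLaw E M = pairLaw A M := by
  refine pairLaw_eq_of_torsionRatio fun d hd => ?_
  obtain ⟨e⟩ := nonempty_addEquiv_prod_of_isCompl h
  rw [← torsionRatio_congr e, torsionRatio_prod, torsionRatio_eq_one (F := B), mul_one]
  rintro ⟨b, hb⟩
  obtain ⟨k, rfl⟩ := hd
  refine Subtype.ext ?_
  change (M * k) • b = 0
  rw [mul_comm, mul_smul, hB b hb, smul_zero]

/-! ### Extracting subsequences -/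

/-- A sequence that is not eventually bounded has a subsequence tending to infinity; otherwise some
value recurs infinitely often. -/
theorem exists_strictMono_tendsto_or_const (a : ℕ → ℕ) :
    ∃ k : ℕ → ℕ, StrictMono k ∧
      (Tendsto (fun i => a (k i)) atTop atTop ∨ ∃ c, ∀ i, a (k i) = c) := by
  by_cases h : ∀ N, ∃ᶠ i in atTop, N ≤ a i
  · obtain ⟨k, hk, h'⟩ := extraction_forall_of_frequently h
    exact ⟨k, hk, Or.inl (tendsto_atTop_mono h' tendsto_id)⟩
  · push Not at h
    obtain ⟨N, hN⟩ := h
    have : ∃ c, ∃ᶠ i in atTop, a i = c := by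
      by_contra hc
      simp only [not_exists, not_frequently] at hc
      have h1 : ∀ᶠ i in atTop, ∀ c ∈ Finset.range N, ¬ a i = c :=
        (eventually_all_finset _).2 fun c _ => hc c
      obtain ⟨i, h2, h3⟩ := (hN.and h1).exists
      exact h3 (a i) (Finset.mem_range.2 (by simpa using h2)) rfl
    obtain ⟨c, hc⟩ := this
    obtain ⟨k, hk, h'⟩ := extraction_of_frequently_atTop hc
    exact ⟨k, hk, Or.inr ⟨c, h'⟩⟩

theorem exists_strictMono_forall_tendsto_or_const {J : Type*} [Finite J] (m : J → ℕ → ℕ) :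
    ∃ k : ℕ → ℕ, StrictMono k ∧
      ∀ j, Tendsto (fun i => m j (k i)) atTop atTop ∨ ∃ c, ∀ i, m j (k i) = c := by
  classical
  have := Fintype.ofFinite J
  suffices h : ∀ S : Finset J, ∃ k : ℕ → ℕ, StrictMono k ∧
      ∀ j ∈ S, Tendsto (fun i => m j (k i)) atTop atTop ∨ ∃ c, ∀ i, m j (k i) = c by
    obtain ⟨k, hk, h'⟩ := h Finset.univ
    exact ⟨k, hk, fun j => h' j (Finset.mem_univ j)⟩
  intro S
  induction S using Finset.induction_on with
  | empty => exact ⟨id, strictMono_id, by simp⟩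
  | insert j S _ ih =>
    obtain ⟨k, hk, h⟩ := ih
    obtain ⟨k', hk', h'⟩ := exists_strictMono_tendsto_or_const fun i => m j (k i)
    refine ⟨k ∘ k', hk.comp hk', fun j' hj' => ?_⟩
    rcases Finset.mem_insert.1 hj' with rfl | hj'
    · exact h'
    · rcases h j' hj' with h1 | ⟨c, hc⟩
      · exact Or.inl (h1.comp hk'.tendsto_atTop)
      · exact Or.inr ⟨c, fun i => hc _⟩

/-! ### Finite abelian groups of bounded exponent -/

/-- A product over `ι` of groups that depend on `f x` only, grouped along the fibers of `f`. -/
def piFiberAddEquiv {ι J : Type*} (f : ι → J) (G : J → Type*) [∀ j, AddCommGroup (G j)] :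
    ((j : J) → {x // f x = j} → G j) ≃+ ((x : ι) → G (f x)) :=
  AddEquiv.ofBijective
    (AddMonoidHom.mk' (fun v x => v (f x) ⟨x, rfl⟩) fun _ _ => rfl) ⟨by
      intro v w h
      ext j ⟨x, rfl⟩
      exact congrFun h x, fun u => ⟨fun j x => x.2 ▸ u x.1, rfl⟩⟩

/-- Every cyclic summand has order at most `c`, so the group is described by multiplicities indexed
by `Fin (c + 1)`, the same index set for all such groups. Indices that are not prime powers have
multiplicity zero. -/
theorem exists_addEquiv_of_maxOrder_le (F : Type*) [AddCommGroup F] [Finite F] {c : ℕ}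
    (hc : maxOrder F ≤ c) :
    ∃ m : Fin (c + 1) → ℕ, (∀ Q, m Q ≠ 0 → ∃ q t : ℕ, q.Prime ∧ (Q : ℕ) = q ^ t) ∧
      Nonempty (F ≃+ ((Q : Fin (c + 1)) → Fin (m Q) → ZMod Q)) := by
  classical
  obtain ⟨ι, _, p, hp, e, ⟨φ⟩⟩ := AddCommGroup.equiv_directSum_zmod_of_finite F
  let ψ : F ≃+ ((x : ι) → ZMod (p x ^ e x)) := φ.trans (DirectSum.addEquivProd _)
  have hle : ∀ x, p x ^ e x < c + 1 := by
    intro x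
    have h1 : addOrderOf (ψ.symm (Pi.single x 1)) = p x ^ e x := by
      refine Eq.trans ?_ (ZMod.addOrderOf_one (p x ^ e x))
      exact addOrderOf_injective (ψ.symm.toAddMonoidHom.comp
        (AddMonoidHom.single (fun x => ZMod (p x ^ e x)) x))
        (ψ.symm.injective.comp fun _ _ h => Pi.single_injective x h) 1
    have := addOrderOf_le_maxOrder (ψ.symm (Pi.single x 1))
    omega
  let f : ι → Fin (c + 1) := fun x => ⟨p x ^ e x, hle x⟩
  refine ⟨fun Q => Nat.card {x // f x = Q}, fun Q hQ => ?_, ⟨?_⟩⟩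
  · have : Nonempty {x // f x = Q} := (Nat.card_ne_zero.1 hQ).1
    obtain ⟨x, rfl⟩ := this
    exact ⟨p x, e x, hp x, rfl⟩
  · exact ψ.trans ((piFiberAddEquiv f fun Q => ZMod Q).symm.trans
      (AddEquiv.piCongrRight fun Q =>
        AddEquiv.arrowCongr (Finite.equivFin {x // f x = Q}) (AddEquiv.refl (ZMod Q))))

/-- Along a subsequence each of the finitely many multiplicities is constant or tends to infinity.
The constant ones make up `E`, the others the growing factors. -/
theorem exists_isTypeThree {n : ℕ → ℕ} {F : ℕ → Type*} [∀ i, AddCommGroup (F i)]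
    [∀ i, Finite (F i)] {N c : ℕ} (hn : ∀ i, n i = N) (hc : ∀ i, maxOrder (F i) ≤ c) :
    ∃ k : ℕ → ℕ, StrictMono k ∧
      ∃ (E : Type) (_ : AddCommGroup E) (_ : Finite E) (s : ℕ) (q t : Fin s → ℕ)
        (m : Fin s → ℕ → ℕ), IsTypeThree (fun i => n (k i)) (fun i => F (k i)) N E s q t m := by
  classical
  choose m hm φ using fun i => exists_addEquiv_of_maxOrder_le (F i) (hc i)
  obtain ⟨k, hk, h⟩ := exists_strictMono_forall_tendsto_or_const fun Q i => m i Q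
  refine ⟨k, hk, ?_⟩
  let T : Fin (c + 1) → Prop := fun Q => Tendsto (fun i => m (k i) Q) atTop atTop
  have hconst : ∀ Q : {Q // ¬ T Q}, ∃ b, ∀ i, m (k i) Q = b := fun Q => (h Q).resolve_left Q.2
  choose b hb using hconst
  have hprime : ∀ Q : {Q // T Q}, ∃ q t : ℕ, q.Prime ∧ (Q : ℕ) = q ^ t := by
    intro Q
    -- A multiplicity that tends to infinity is nonzero somewhere, so its index is a prime power.
    obtain ⟨i, hi⟩ := (Q.2.eventually_gt_atTop 0).exists
    exact hm (k i) Q hi.ne'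
  choose q t hq hqt using hprime
  let E : Type := (Q : {Q // ¬ T Q}) → Fin (b Q) → ZMod Q.1
  let e : {Q // T Q} ≃ Fin (Nat.card {Q // T Q}) := Finite.equivFin _
  have hsplit : ∀ i, Nonempty (F (k i) ≃+ E × ((j : Fin (Nat.card {Q // T Q})) →
      Fin (m (k i) (e.symm j)) → ZMod (q (e.symm j) ^ t (e.symm j)))) := by
    intro i
    obtain ⟨φ⟩ := φ (k i)
    let P : ((Q : Fin (c + 1)) → Fin (m (k i) Q) → ZMod Q) ≃+
        ((Q : {Q // T Q}) → Fin (m (k i) Q) → ZMod Q.1) ×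
          ((Q : {Q // ¬ T Q}) → Fin (m (k i) Q) → ZMod Q.1) :=
      { Equiv.piEquivPiSubtypeProd T (fun Q => Fin (m (k i) Q) → ZMod Q) with
        map_add' := fun _ _ => rfl }
    let P₁ : ((Q : {Q // ¬ T Q}) → Fin (m (k i) Q) → ZMod Q.1) ≃+ E :=
      AddEquiv.piCongrRight fun Q => AddEquiv.arrowCongr (finCongr (hb Q i)) (AddEquiv.refl _)
    let P₂ : ((Q : {Q // T Q}) → Fin (m (k i) Q) → ZMod Q.1) ≃+
        ((Q : {Q // T Q}) → Fin (m (k i) Q) → ZMod (q Q ^ t Q)) :=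
      AddEquiv.piCongrRight fun Q =>
        AddEquiv.arrowCongr (Equiv.refl _) (ZMod.ringEquivCongr (hqt Q)).toAddEquiv
    let P₃ : ((Q : {Q // T Q}) → Fin (m (k i) Q) → ZMod (q Q ^ t Q)) ≃+
        ((j : Fin (Nat.card {Q // T Q})) →
          Fin (m (k i) (e.symm j)) → ZMod (q (e.symm j) ^ t (e.symm j))) :=
      { Equiv.piCongrLeft' (fun Q : {Q // T Q} => Fin (m (k i) Q) → ZMod (q Q ^ t Q)) e with
        map_add' := fun _ _ => rfl }
    exact ⟨φ.trans (P.trans (AddEquiv.prodComm.trans (P₁.prodCongr (P₂.trans P₃))))⟩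
  -- Finiteness is read off from a surjection `F (k 0) → E`, which avoids a separate discussion of
  -- the index `Q = 0`, where `ZMod 0` is infinite.
  have hE : Finite E := by
    obtain ⟨g⟩ := hsplit 0
    exact Finite.of_surjective (fun x => (g x).1) (Prod.fst_surjective.comp g.surjective)
  exact ⟨E, inferInstance, hE, _, fun j => q (e.symm j), fun j => t (e.symm j),
    fun j i => m (k i) (e.symm j), Eventually.of_forall fun i => hn _, fun j => hq _,
    Eventually.of_forall hsplit, fun j => (e.symm j).2⟩

theorem exists_subsequence_type (n : ℕ → ℕ) (F : ℕ → Type*) [∀ i, AddCommGroup (F i)]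
    [∀ i, Finite (F i)] :
    ∃ k : ℕ → ℕ, StrictMono k ∧
      (IsTypeOne (fun i => n (k i)) ∨ IsTypeTwo (fun i => n (k i)) (fun i => F (k i)) ∨
        ∃ (N : ℕ) (E : Type) (_ : AddCommGroup E) (_ : Finite E) (s : ℕ) (q t : Fin s → ℕ)
          (m : Fin s → ℕ → ℕ),
          IsTypeThree (fun i => n (k i)) (fun i => F (k i)) N E s q t m) := by
  obtain ⟨k, hk, h | ⟨N, hN⟩⟩ := exists_strictMono_tendsto_or_const n
  · exact ⟨k, hk, Or.inl h⟩
  obtain ⟨k', hk', h | ⟨c, hc⟩⟩ := exists_strictMono_tendsto_or_const fun i => maxOrder (F (k i))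
  · exact ⟨k ∘ k', hk.comp hk', Or.inr (Or.inl ⟨⟨N, Eventually.of_forall fun i => hN _⟩, h⟩)⟩
  obtain ⟨k'', hk'', h⟩ := exists_isTypeThree (n := fun i => n (k (k' i)))
    (F := fun i => F (k (k' i))) (fun i => hN _) fun i => (hc i).le
  exact ⟨fun i => k (k' (k'' i)), hk.comp (hk'.comp hk''), Or.inr (Or.inr ⟨N, h⟩)⟩

end

/-- Convergence of indecomposable characteristic random subgroups of the infinite-dimensional torus,
and the Bauer property of the simplex that they span. -/
theorem mainTheorem10 :
    (∀ (lam : ℕ → ProbabilityMeasure (ClosedAddSubgroup Torus)) (n : ℕ → ℕ) (F : ℕ → Type*)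
      [∀ i, AddCommGroup (F i)] [∀ i, Finite (F i)] [∀ i, TopologicalSpace (F i)]
      [∀ i, DiscreteTopology (F i)],
      (∀ i, lam i ∈ CRSe Torus) → (∀ i, Corresponds (F i) (lam i) (n i)) →
      -- first type
      (IsTypeOne n → Tendsto lam atTop (𝓝 (diracFull Torus))) ∧
      -- second type (it is not needed that `n i` stabilizes)
      (Tendsto (fun i => maxOrder (F i)) atTop atTop → Tendsto lam atTop (𝓝 (diracFull Torus))) ∧
      -- third type
      (∀ (N : ℕ) (E : Type*) [AddCommGroup E] [Finite E] [TopologicalSpace E] [DiscreteTopology E]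
        (s : ℕ) (q t : Fin s → ℕ) (m : Fin s → ℕ → ℕ),
        IsTypeThree n F N E s q t m →
        pairLaw E (limitModulus N q t) ∈ CRSe Torus ∧
          Tendsto lam atTop (𝓝 (pairLaw E (limitModulus N q t))) ∧
          -- the pair of the limit: discard a direct summand of `E` killed by the modulus
          (∃ A B : AddSubgroup E, IsCompl A B ∧ (∀ b ∈ B, limitModulus N q t • b = 0) ∧
            Corresponds A (pairLaw E (limitModulus N q t)) (limitModulus N q t)) ∧
          (IsOver E (limitModulus N q t) →
            Corresponds E (pairLaw E (limitModulus N q t)) (limitModulus N q t))) ∧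
      -- every sequence has a subsequence of one of the three types
      (∃ k : ℕ → ℕ, StrictMono k ∧
        (IsTypeOne (fun i => n (k i)) ∨ IsTypeTwo (fun i => n (k i)) (fun i => F (k i)) ∨
          ∃ (N : ℕ) (E : Type) (_ : AddCommGroup E) (_ : Finite E) (s : ℕ) (q t : Fin s → ℕ)
            (m : Fin s → ℕ → ℕ),
            IsTypeThree (fun i => n (k i)) (fun i => F (k i)) N E s q t m))) ∧
    IsClosed {μ : CRS Torus | (μ : ProbabilityMeasure (ClosedAddSubgroup Torus)) ∈ CRSe Torus} ∧
    IsBauerSimplex (CRS Torus) := by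
  refine ⟨?_, isClosed_CRSe.preimage continuous_subtype_val, isBauerSimplex_CRS⟩
  intro lam n F _ _ _ _ _ hcor
  have hlam : lam = fun i => pairLaw (F i) (n i) := funext fun i => (hcor i).2
  refine ⟨fun h => ?_, fun h => ?_, fun N E _ _ _ _ s q t m h => ?_, exists_subsequence_type n F⟩
  · rw [hlam]
    exact tendsto_pairLaw_of_isTypeOne h
  · rw [hlam]
    exact tendsto_pairLaw_of_maxOrder h
  · refine ⟨pairLaw_mem_CRSe E _, ?_, ?_, fun hover => ⟨hover, rfl⟩⟩
    · rw [hlam]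
      exact tendsto_pairLaw_of_isTypeThree h
    · obtain ⟨A, B, hAB, hB, hover⟩ := exists_isCompl_isOver E (limitModulus N q t)
      exact ⟨A, B, hAB, hB, hover, pairLaw_eq_of_isCompl hAB hB⟩
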